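/- **Theorem 3.3.** *Setting.* Let $d\ge 1$. Either (i) $\Omega=\prod_{i=1}^d(0,L_i)$ with $L_i>0$ and all variables are periodic, or (ii) $\Omega\subset\mathbb R^d$ is a nonempty bounded connected open set with the interior cone property (there is $r>0$ such that for every $x\in\Omega$ there is a ball $B$ of radius $r$ with $\operatorname{conv}(\{x\}\cup B)\subset\Omega$; every bounded Lipschitz domain is of this kind), with the boundary conditions $\partial_{\mathbf n}\phi=\nabla\mu\cdot\mathbf n=0$ on $\partial\Omega$. Let $H^1(\Omega)$ be the Sobolev space, the periodic one in case (i); $(\cdot,\cdot)$ and $\|\cdot\|$ are the inner product and the norm of $L^2(\Omega)$. Let $0<\sigma<\tfrac12$, $\theta>1$, $\epsilon>0$, $\delta t>0$, let $$F(s)=\begin{cases} s\ln s+\frac{(1-s)^2}{2\sigma}+(1-s)\ln\sigma-\frac\sigma2+\theta(s-s^2), & s\ge 1-\sigma,\\ s\ln s+(1-s)\ln(1-s)+\theta(s-s^2), & \sigma\le s\le 1-\sigma,\\ (1-s)\ln(1-s)+\frac{s^2}{2\sigma}+s\ln\sigma-\frac\sigma2+\theta(s-s^2), & s\le\sigma,\end{cases}$$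 let $B$ be a constant with $F(s)+B>0$ for all $s\in\mathbb R$, let $H=F'/\sqrt{F+B}$, and let $$M(s)=\begin{cases}\frac14\bigl(1-(1-\sigma)(2s-1)^2\bigr), & 0\le s\le 1,\\ \frac18\sigma\bigl(1+e^{-2(1-\sigma)((2s-1)^2-1)/\sigma}\bigr), & \text{otherwise.}\end{cases}$$ Let $\phi^{n-1},\phi^n\in H^1(\Omega)$ and $U^{n-1},U^n\in L^2(\Omega)$ be arbitrary, and put $\phi^*=2\phi^n-\phi^{n-1}$, $H^*=H(\phi^*)$. *The scheme.* The BDF2 scheme asks for $\phi^{n+1},\mu^{n+1}\in H^1(\Omega)$ and $U^{n+1}\in L^2(\Omega)$ with $$\Bigl(\tfrac{3\phi^{n+1}-4\phi^n+\phi^{n-1}}{2\delta t},v\Bigr)=-(M(\phi^*)\nabla\mu^{n+1},\nabla v)\quad\forall v\in H^1(\Omega),$$ $$(\mu^{n+1},w)=\epsilon^2(\nabla\phi^{n+1},\nabla w)+(U^{n+1}H^*,w)\quad\forall w\in H^1(\Omega),$$ $$2(3U^{n+1}-4U^n+U^{n-1})=H^*(3\phi^{n+1}-4\phi^n+\phi^{n-1})\quad\text{a.e.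 in }\Omega,$$ that is, for a weak solution of $\frac{3\phi^{n+1}-4\phi^n+\phi^{n-1}}{2\delta t}=\nabla\cdot(M(\phi^*)\nabla\mu^{n+1})$, $\mu^{n+1}=-\epsilon^2\Delta\phi^{n+1}+U^{n+1}H^*$ with the boundary conditions, together with the last equation. Eliminating $U^{n+1}$ gives the reduced system, which consists of the first equation and the weak form of $\mu^{n+1}=P_2\phi^{n+1}+g$, where $P_2\psi=-\epsilon^2\Delta\psi+\frac12H^*H^*\psi$, that is $(P_2\psi,\chi)=\epsilon^2(\nabla\psi,\nabla\chi)+\frac12(H^*\psi,H^*\chi)$, and $g=H^*\frac{4U^n-U^{n-1}}3-\frac12H^*H^*\frac{4\phi^n-\phi^{n-1}}3$. *Claims.* 1. The scheme has exactly one solution $(\phi^{n+1},\mu^{n+1},U^{n+1})\in H^1(\Omega)\times H^1(\Omega)\times L^2(\Omega)$, and the reduced system has exactly one solution $(\phi^{n+1},\mu^{n+1})\in H^1(\Omega)\times H^1(\Omega)$. 2. Let $V=\{\psi\in H^1(\Omega):\int_\Omega\psi\,dx=0\}$. For every $\psi\in V$ there is exactly one $v=:\Delta^{-1}\psi\in V$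 with $-(M(\phi^*)\nabla v,\nabla w)=(\psi,w)$ for all $w\in H^1(\Omega)$. The linear operator of the scheme, $\mathbb A\psi=-\frac{3}{2\delta t}\Delta^{-1}\psi+P_2\psi$, is a bounded operator from $V$ to its dual. A function $\phi^{n+1}\in H^1(\Omega)$ is the $\phi$-component of a solution of the scheme if and only if $\psi=\phi^{n+1}-\frac{4\phi^n-\phi^{n-1}}3$ lies in $V$ and $(\mathbb A\psi,\chi)=-\epsilon^2\bigl(\nabla\tfrac{4\phi^n-\phi^{n-1}}3,\nabla\chi\bigr)-\bigl(H^*\tfrac{4U^n-U^{n-1}}3,\chi\bigr)$ for all $\chi\in V$. Moreover $\mathbb A$ is symmetric (self-adjoint), $(\mathbb A\psi,\chi)=(\psi,\mathbb A\chi)$, and positive definite: $(\mathbb A\psi,\psi)>0$ for $0\ne\psi\in V$, and there is $C>0$ with $(\mathbb A\psi,\psi)\ge C\|\psi\|_{H^1}^2$ for all $\psi\in V$. 3. Every solution of the scheme satisfies $$\frac1{\delta t}\bigl(E_{bdf2}^{n+1}-E_{bdf2}^n\bigr)\le-\|\sqrt{M(\phi^*)}\nabla\mu^{n+1}\|^2\le0,$$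 where, for $k=n,n+1$, $$E_{bdf2}^{k}=\frac{\epsilon^2}2\Bigl(\frac{\|\nabla\phi^{k}\|^2}2+\frac{\|2\nabla\phi^{k}-\nabla\phi^{k-1}\|^2}2\Bigr)+\Bigl(\frac{\|U^{k}\|^2}2+\frac{\|2U^{k}-U^{k-1}\|^2}2\Bigr)-B|\Omega|.$$ -/

import Mathlib

open MeasureTheory
open scoped ContDiff

noncomputable section

namespace CahnHilliard

/-- Euclidean space `ℝᵈ`. -/
abbrev Space (d : ℕ) : Type := EuclideanSpace ℝ (Fin d)

/-- A bounded domain (nonempty connected open set) with the interior cone property: for some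
fixed `r > 0`, every point `x` of `Ω` is the vertex of a solid "ice-cream cone", the convex hull of
`x` and a ball of radius `r`, contained in `Ω`.
Bounded Lipschitz domains and bounded convex domains are of this kind. -/
structure IsConeDomain {d : ℕ} (Ω : Set (Space d)) : Prop where
  isOpen : IsOpen Ω
  isConnected : IsConnected Ω
  isBounded : Bornology.IsBounded Ω
  cone : ∃ r : ℝ, 0 < r ∧ ∀ x ∈ Ω, ∃ y : Space d, convexHull ℝ (insert x (Metric.ball y r)) ⊆ Ω

/-- The spatial domain together with the boundary condition:
either a box `∏ᵢ (0, Lᵢ)` on which all variables are periodic, or a bounded domain `Ω` with the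
no-flux conditions `∂ₙφ = ∇μ · n = 0` on `∂Ω`. -/
inductive Setting (d : ℕ) : Type
  | periodic (L : Fin d → ℝ) (hL : ∀ i, 0 < L i) : Setting d
  | noFlux (Ω : Set (Space d)) (hΩ : IsConeDomain Ω) : Setting d

namespace Setting

variable {d : ℕ}

/-- The domain `Ω`. -/
def domain : Setting d → Set (Space d)
  | periodic L _ => {x | ∀ i, x i ∈ Set.Ioo 0 (L i)}
  | noFlux Ω _ => Ω

/-- The test functions that define weak derivatives: smooth periodic functions in the periodic
case, smooth functions with compact support in `Ω` in the no-flux case. -/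
def IsTest : Setting d → (Space d → ℝ) → Prop
  | periodic L _, ζ => ContDiff ℝ ∞ ζ ∧ ∀ x i, ζ (x + EuclideanSpace.single i (L i)) = ζ x
  | noFlux Ω _, ζ => ContDiff ℝ ∞ ζ ∧ HasCompactSupport ζ ∧ tsupport ζ ⊆ Ω

/-- Lebesgue measure on `Ω`. -/
def vol (G : Setting d) : Measure (Space d) := volume.restrict G.domain

theorem isBounded_domain (G : Setting d) : Bornology.IsBounded G.domain := by
  cases G with
  | noFlux Ω hΩ => exact hΩ.isBounded
  | periodic L hL =>
    refine (Metric.isBounded_closedBall (x := (0 : Space d)) (r := √(∑ i, L i ^ 2))).subset ?_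
    intro x hx
    rw [mem_closedBall_zero_iff, EuclideanSpace.norm_eq]
    refine Real.sqrt_le_sqrt (Finset.sum_le_sum fun i _ => ?_)
    have h := hx i
    rw [Real.norm_of_nonneg h.1.le]
    exact pow_le_pow_left₀ h.1.le h.2.le 2

instance (G : Setting d) : IsFiniteMeasure G.vol :=
  ⟨by simpa [vol] using G.isBounded_domain.measure_lt_top⟩

theorem memLp_of_continuous (G : Setting d) {g : Space d → ℝ} (hg : Continuous g) :
    MemLp g 2 G.vol := by
  obtain ⟨C, hC⟩ := (G.isBounded_domain.isCompact_closure).exists_bound_of_continuousOn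
    hg.continuousOn
  refine MemLp.of_bound hg.aestronglyMeasurable C ?_
  have h : ∀ᵐ x ∂(volume.restrict (closure G.domain)), ‖g x‖ ≤ C :=
    (ae_restrict_iff' isClosed_closure.measurableSet).2 (Filter.Eventually.of_forall hC)
  exact ae_restrict_of_ae_restrict_of_subset subset_closure h

theorem IsTest.contDiff {G : Setting d} {ζ : Space d → ℝ} (h : G.IsTest ζ) : ContDiff ℝ ∞ ζ := by
  cases G with
  | noFlux Ω hΩ => exact h.1
  | periodic L hL => exact h.1

end Setting

variable {d : ℕ}

/-- `L²(Ω)`. -/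
abbrev L2 (G : Setting d) : Type := Lp ℝ 2 G.vol

/-- `L²(Ω)ᵈ`, the space of square integrable vector fields. -/
abbrev L2Vec (G : Setting d) : Type := Lp (Space d) 2 G.vol

theorem integrable_mul_test {G : Setting d} (u : L2 G) {g : Space d → ℝ} (hg : Continuous g) :
    Integrable (fun x => u x * g x) G.vol :=
  (Lp.memLp u).integrable_mul (G.memLp_of_continuous hg)

theorem integrable_coord_mul_test {G : Setting d} (u : L2Vec G) (i : Fin d) {g : Space d → ℝ}
    (hg : Continuous g) : Integrable (fun x => u x i * g x) G.vol :=
  (((EuclideanSpace.proj i : Space d →L[ℝ] ℝ)).comp_memLp' (Lp.memLp u)).integrable_mul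
    (G.memLp_of_continuous hg)

/-- The Sobolev space `H¹(Ω)` (the periodic one in the periodic case), as the space of the pairs
`(u, ∇u)` of an `L²` function and its weak gradient in `L²`. The weak gradient is unique, and the
norm of the ambient `ℓ²` product is the `H¹` norm `(‖u‖² + ‖∇u‖²)^(1/2)`. -/
def H1 (G : Setting d) : Submodule ℝ (WithLp 2 (L2 G × L2Vec G)) where
  carrier := {q | ∀ ζ : Space d → ℝ, G.IsTest ζ → ∀ i : Fin d,
    ∫ x, q.fst x * fderiv ℝ ζ x (EuclideanSpace.single i 1) ∂G.vol
      = -∫ x, q.snd x i * ζ x ∂G.vol}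
  zero_mem' := by
    intro ζ _ i
    have h1 : (fun x => ((0 : L2 G) : Space d → ℝ) x * fderiv ℝ ζ x (EuclideanSpace.single i 1))
        =ᵐ[G.vol] fun _ => (0 : ℝ) := by
      filter_upwards [Lp.coeFn_zero ℝ 2 G.vol] with x hx
      rw [hx, Pi.zero_apply, zero_mul]
    have h2 : (fun x => ((0 : L2Vec G) : Space d → Space d) x i * ζ x)
        =ᵐ[G.vol] fun _ => (0 : ℝ) := by
      filter_upwards [Lp.coeFn_zero (Space d) 2 G.vol] with x hx
      rw [hx, Pi.zero_apply, PiLp.zero_apply, zero_mul]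
    change ∫ x, ((0 : L2 G) : Space d → ℝ) x * _ ∂G.vol
      = -∫ x, ((0 : L2Vec G) : Space d → Space d) x i * ζ x ∂G.vol
    rw [integral_congr_ae h1, integral_congr_ae h2]
    simp
  add_mem' := by
    intro p q hp hq ζ hζ i
    have c1 : Continuous ζ := hζ.contDiff.continuous
    have c2 : Continuous fun x => fderiv ℝ ζ x (EuclideanSpace.single i 1) :=
      (hζ.contDiff.continuous_fderiv (by simp)).clm_apply continuous_const
    have h1 : (fun x => (p.fst + q.fst : L2 G) x * fderiv ℝ ζ x (EuclideanSpace.single i 1))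
        =ᵐ[G.vol] fun x => p.fst x * fderiv ℝ ζ x (EuclideanSpace.single i 1)
          + q.fst x * fderiv ℝ ζ x (EuclideanSpace.single i 1) := by
      filter_upwards [Lp.coeFn_add p.fst q.fst] with x hx
      rw [hx, Pi.add_apply, add_mul]
    have h2 : (fun x => (p.snd + q.snd : L2Vec G) x i * ζ x)
        =ᵐ[G.vol] fun x => p.snd x i * ζ x + q.snd x i * ζ x := by
      filter_upwards [Lp.coeFn_add p.snd q.snd] with x hx
      rw [hx, Pi.add_apply, PiLp.add_apply, add_mul]
    change ∫ x, (p.fst + q.fst : L2 G) x * _ ∂G.vol = -∫ x, (p.snd + q.snd : L2Vec G) x i * ζ x ∂G.vol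
    rw [integral_congr_ae h1, integral_congr_ae h2,
      integral_add (integrable_mul_test _ c2) (integrable_mul_test _ c2),
      integral_add (integrable_coord_mul_test _ i c1) (integrable_coord_mul_test _ i c1),
      hp ζ hζ i, hq ζ hζ i]
    ring
  smul_mem' := by
    intro c p hp ζ hζ i
    have h1 : (fun x => (c • p.fst : L2 G) x * fderiv ℝ ζ x (EuclideanSpace.single i 1))
        =ᵐ[G.vol] fun x => c * (p.fst x * fderiv ℝ ζ x (EuclideanSpace.single i 1)) := by
      filter_upwards [Lp.coeFn_smul c p.fst] with x hx
      rw [hx, Pi.smul_apply, smul_eq_mul, mul_assoc]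
    have h2 : (fun x => (c • p.snd : L2Vec G) x i * ζ x)
        =ᵐ[G.vol] fun x => c * (p.snd x i * ζ x) := by
      filter_upwards [Lp.coeFn_smul c p.snd] with x hx
      rw [hx, Pi.smul_apply, PiLp.smul_apply, smul_eq_mul, mul_assoc]
    change ∫ x, (c • p.fst : L2 G) x * _ ∂G.vol = -∫ x, (c • p.snd : L2Vec G) x i * ζ x ∂G.vol
    rw [integral_congr_ae h1, integral_congr_ae h2, integral_const_mul, integral_const_mul,
      hp ζ hζ i]
    ring

/-- The function underlying an element of `H¹(Ω)`. -/
def toL2 {G : Setting d} (u : H1 G) : L2 G := (u : WithLp 2 (L2 G × L2Vec G)).fst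

/-- The weak gradient of an element of `H¹(Ω)`. -/
def grad {G : Setting d} (u : H1 G) : L2Vec G := (u : WithLp 2 (L2 G × L2Vec G)).snd

/-- The `H¹(Ω)` functions with vanishing mean. -/
def MeanZero (G : Setting d) : Submodule ℝ (H1 G) where
  carrier := {u | ∫ x, toL2 u x ∂G.vol = 0}
  zero_mem' := by
    change ∫ x, ((0 : L2 G) : Space d → ℝ) x ∂G.vol = 0
    rw [integral_congr_ae (Lp.coeFn_zero ℝ 2 G.vol)]
    simp
  add_mem' := by
    intro u v hu hv
    change ∫ x, (toL2 u + toL2 v : L2 G) x ∂G.vol = 0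
    rw [integral_congr_ae (Lp.coeFn_add (toL2 u) (toL2 v))]
    simp only [Pi.add_apply]
    rw [integral_add ((Lp.memLp (toL2 u)).integrable (by norm_num))
      ((Lp.memLp (toL2 v)).integrable (by norm_num))]
    rw [show ∫ x, toL2 u x ∂G.vol = 0 from hu, show ∫ x, toL2 v x ∂G.vol = 0 from hv, add_zero]
  smul_mem' := by
    intro c u hu
    change ∫ x, (c • toL2 u : L2 G) x ∂G.vol = 0
    rw [integral_congr_ae (Lp.coeFn_smul c (toL2 u))]
    simp only [Pi.smul_apply, smul_eq_mul]
    rw [integral_const_mul, show ∫ x, toL2 u x ∂G.vol = 0 from hu, mul_zero]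

/-- The parameters of the model and of the scheme: regularization `σ`, Flory-Huggins parameter `θ`,
shift `B` of the potential, interfacial width `ε`, time step `δt`. -/
structure Params where
  σ : ℝ
  θ : ℝ
  B : ℝ
  ε : ℝ
  δt : ℝ

namespace Params

/-- The regularized logarithmic Flory-Huggins potential `F`. -/
def potential (p : Params) (s : ℝ) : ℝ :=
  if 1 - p.σ ≤ s then
    s * Real.log s + (1 - s) ^ 2 / (2 * p.σ) + (1 - s) * Real.log p.σ - p.σ / 2
      + p.θ * (s - s ^ 2)
  else if p.σ ≤ s then
    s * Real.log s + (1 - s) * Real.log (1 - s) + p.θ * (s - s ^ 2)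
  else
    (1 - s) * Real.log (1 - s) + s ^ 2 / (2 * p.σ) + s * Real.log p.σ - p.σ / 2
      + p.θ * (s - s ^ 2)

/-- `H = f / √(F + B)` with `f = F'`. -/
def H (p : Params) (s : ℝ) : ℝ := deriv p.potential s / √(p.potential s + p.B)

/-- The mobility `M`. -/
def mobility (p : Params) (s : ℝ) : ℝ :=
  if 0 ≤ s ∧ s ≤ 1 then 1 / 4 * (1 - (1 - p.σ) * (2 * s - 1) ^ 2)
  else 1 / 8 * p.σ * (1 + Real.exp (-2 * (1 - p.σ) * ((2 * s - 1) ^ 2 - 1) / p.σ))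

/-- The standing assumptions on the parameters: `0 < σ` small, `θ > 1`, `ε > 0`, `δt > 0`, and `B`
makes `F + B` positive on the real line. -/
structure Admissible (p : Params) : Prop where
  σ_pos : 0 < p.σ
  σ_lt : p.σ < 1 / 2
  θ_gt : 1 < p.θ
  ε_pos : 0 < p.ε
  δt_pos : 0 < p.δt
  B_spec : ∀ s : ℝ, 0 < p.potential s + p.B

end Params

/-- The extrapolation `φ* = 2 φⁿ - φⁿ⁻¹`; the arguments are `φⁿ⁻¹` and `φⁿ`. -/
def extrap {G : Setting d} (φo φn : H1 G) (x : Space d) : ℝ := 2 * toL2 φn x - toL2 φo x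

/-- The weak form, against all `v ∈ H¹(Ω)`, of
`(3 φⁿ⁺¹ - 4 φⁿ + φⁿ⁻¹) / (2 δt) = ∇ · (M(φ*) ∇μⁿ⁺¹)` with the boundary condition on `μⁿ⁺¹`.
Here `φo = φⁿ⁻¹`, `φn = φⁿ`, `φ = φⁿ⁺¹`, `μ = μⁿ⁺¹`. -/
def MassEquation {G : Setting d} (p : Params) (φo φn φ μ : H1 G) : Prop :=
  ∀ v : H1 G,
    ∫ x, (3 * toL2 φ x - 4 * toL2 φn x + toL2 φo x) / (2 * p.δt) * toL2 v x ∂G.vol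
      = -∫ x, p.mobility (extrap φo φn x) * inner ℝ (grad μ x) (grad v x) ∂G.vol

/-- The BDF2 scheme for `(φⁿ⁺¹, μⁿ⁺¹, Uⁿ⁺¹) = (φ, μ, U)`, given `φo = φⁿ⁻¹`, `φn = φⁿ`, `Uo = Uⁿ⁻¹`,
`Un = Uⁿ`: the mass equation, the weak form of `μⁿ⁺¹ = -ε² Δφⁿ⁺¹ + Uⁿ⁺¹ H*` with the boundary
condition on `φⁿ⁺¹`, and `2 (3 Uⁿ⁺¹ - 4 Uⁿ + Uⁿ⁻¹) = H* (3 φⁿ⁺¹ - 4 φⁿ + φⁿ⁻¹)` almost everywhere,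
where `H* = H(φ*)`. -/
structure IsBDF2Step {G : Setting d} (p : Params) (φo φn : H1 G) (Uo Un : L2 G)
    (φ μ : H1 G) (U : L2 G) : Prop where
  mass : MassEquation p φo φn φ μ
  potential : ∀ w : H1 G,
    ∫ x, toL2 μ x * toL2 w x ∂G.vol
      = p.ε ^ 2 * ∫ x, inner ℝ (grad φ x) (grad w x) ∂G.vol
        + ∫ x, U x * p.H (extrap φo φn x) * toL2 w x ∂G.vol
  auxiliary : ∀ᵐ x ∂G.vol,
    2 * (3 * U x - 4 * Un x + Uo x)
      = p.H (extrap φo φn x) * (3 * toL2 φ x - 4 * toL2 φn x + toL2 φo x)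

/-- The pairing `(P₂ ψ, χ)` of `P₂ ψ = -ε² Δψ + ½ H* H* ψ` with `χ`. -/
def formP {G : Setting d} (p : Params) (φo φn ψ χ : H1 G) : ℝ :=
  p.ε ^ 2 * ∫ x, inner ℝ (grad ψ x) (grad χ x) ∂G.vol
    + 1 / 2 * ∫ x, (p.H (extrap φo φn x) * toL2 ψ x) * (p.H (extrap φo φn x) * toL2 χ x) ∂G.vol

/-- The scheme after elimination of `Uⁿ⁺¹`: the mass equation and `μⁿ⁺¹ = P₂ φⁿ⁺¹ + g`,
with `g = H* (4 Uⁿ - Uⁿ⁻¹) / 3 - ½ H* H* (4 φⁿ - φⁿ⁻¹) / 3`. -/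
structure IsReducedStep {G : Setting d} (p : Params) (φo φn : H1 G) (Uo Un : L2 G)
    (φ μ : H1 G) : Prop where
  mass : MassEquation p φo φn φ μ
  potential : ∀ w : H1 G,
    ∫ x, toL2 μ x * toL2 w x ∂G.vol
      = formP p φo φn φ w
        + ∫ x, (p.H (extrap φo φn x) * ((4 * Un x - Uo x) / 3)
            - 1 / 2 * p.H (extrap φo φn x) ^ 2 * ((4 * toL2 φn x - toL2 φo x) / 3)) * toL2 w x ∂G.vol

/-- `v = Δ⁻¹ u`, the inverse quasi-Laplacian: `∇ · (M(φ*) ∇v) = u` weakly, with the boundary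
condition, and `∫ v = 0`. -/
def IsInvQuasiLaplace {G : Setting d} (p : Params) (φo φn : H1 G) (u v : MeanZero G) : Prop :=
  ∀ w : H1 G,
    -∫ x, p.mobility (extrap φo φn x) * inner ℝ (grad v.1 x) (grad w x) ∂G.vol
      = ∫ x, toL2 u.1 x * toL2 w x ∂G.vol

/-- `A` is the linear operator `ψ ↦ -(3 / (2 δt)) Δ⁻¹ ψ + P₂ ψ` on the mean-zero functions of
`H¹(Ω)`, as a bounded operator from that space into its dual. (Additive constants vanish when they
are tested against functions with zero mean.) -/
def IsSchemeOperator {G : Setting d} (p : Params) (φo φn : H1 G)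
    (A : MeanZero G →L[ℝ] (MeanZero G →L[ℝ] ℝ)) : Prop :=
  ∀ ψ v : MeanZero G, IsInvQuasiLaplace p φo φn ψ v → ∀ χ : MeanZero G,
    A ψ χ = -(3 / (2 * p.δt)) * ∫ x, toL2 v.1 x * toL2 χ.1 x ∂G.vol + formP p φo φn ψ.1 χ.1

/-- The average `(4 φⁿ - φⁿ⁻¹) / 3` of the data; the scheme is an equation for the difference of
`φⁿ⁺¹` and this average, which has mean zero. -/
def history {G : Setting d} (φo φn : H1 G) : H1 G := (1 / 3 : ℝ) • ((4 : ℝ) • φn - φo)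

/-- The right-hand side of the equation `A (φⁿ⁺¹ - history) = b` that is equivalent to the scheme:
`b = ε² Δ(4 φⁿ - φⁿ⁻¹) / 3 - H* (4 Uⁿ - Uⁿ⁻¹) / 3`, paired with `χ`. -/
def schemeRhs {G : Setting d} (p : Params) (φo φn : H1 G) (Uo Un : L2 G) (χ : MeanZero G) : ℝ :=
  -(p.ε ^ 2 * ∫ x, inner ℝ (grad (history φo φn) x) (grad χ.1 x) ∂G.vol)
    - ∫ x, p.H (extrap φo φn x) * ((4 * Un x - Uo x) / 3) * toL2 χ.1 x ∂G.vol

/-- The energy `E_bdf2` of the state `(φ, U)` with previous state `(φ', U')`. -/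
def energy {G : Setting d} (p : Params) (φ' φ : H1 G) (U' U : L2 G) : ℝ :=
  p.ε ^ 2 / 2 * (‖grad φ‖ ^ 2 / 2 + ‖(2 : ℝ) • grad φ - grad φ'‖ ^ 2 / 2)
    + (‖U‖ ^ 2 / 2 + ‖(2 : ℝ) • U - U'‖ ^ 2 / 2)
    - p.B * volume.real G.domain

/-- The dissipation `‖√M(φ*) ∇μ‖²`. -/
def dissipation {G : Setting d} (p : Params) (φo φn μ : H1 G) : ℝ :=
  ∫ x, ‖√(p.mobility (extrap φo φn x)) • grad μ x‖ ^ 2 ∂G.vol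

end CahnHilliard

end

open CahnHilliard

/-!
The auxiliary equation gives `Uⁿ⁺¹ = (4 Uⁿ - Uⁿ⁻¹) / 3 + ½ H* ψ` with
`ψ = φⁿ⁺¹ - (4 φⁿ - φⁿ⁻¹) / 3`, so the scheme is a linear system for `(ψ, μⁿ⁺¹)`
(`isBDF2Step_iff`, `isReducedStep_iff`). Its mass equation, tested with constants, says that `ψ` has
mean zero, and it gives `μⁿ⁺¹ = (3 / (2 δt)) Δ⁻¹ψ` up to a constant; the second equation then
becomes `A ψ = b` on the mean-zero functions, and its test with constants fixes the constant. Both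
`Δ⁻¹` and the solution of `A ψ = b` come from the Lax-Milgram theorem: the nonlocal part of `A` is
`(3 / (2 δt)) (M ∇Δ⁻¹ψ, ∇Δ⁻¹χ)`, symmetric and nonnegative, and `ε² ‖∇ψ‖²` is coercive by the
Poincaré inequality. This part of the argument only sees Hilbert spaces and is carried out for
`VariationalData`. The energy law is `bdf2_inner_ge` applied to `∇φ` and to `U`, after testing with
`μⁿ⁺¹` and `ψ` (`energy_law`).

Three facts from analysis feed the abstract problem.

* The coefficients are bounded. `M` lies between `σ / 8` and `1 / 4`. For `H` no information on the
  growth of the potential is needed: its derivative grows at most with slope `2 / σ`, and a positive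
  function with this property satisfies `F'² ≤ (8 / σ) (F + B)` (`sq_deriv_le_of_pos`,
  `Params.H_sq_le`).
* The Poincaré inequality (`exists_poincare`). If all segments between two sets `A` and `N` lie in
  `Ω`, then `∫_A ∫_N |u(x) - u(z)|² dz dx` is controlled by the weak gradient
  (`lintegral_sq_sub_le`): mollify, integrate the gradient along segments, and change variables in
  the end point that has the larger weight; Fatou's lemma removes the mollification. Such estimates
  can be chained through sets of positive measure (`Linked.trans`). A box is convex. A cone domain
  is a finite union of sets each of which sees some ball, and by connectedness these balls are
  chained to each other (`IsConeDomain.linked`).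
* In the periodic setting, a smooth function with compact support in the box extends periodically
  (`contDiff_comp_wrap`), so periodic `H¹` functions are weakly differentiable in the box, and
  constants belong to `H¹` because the integral of a derivative of a periodic function vanishes
  (`setIntegral_fderiv_periodic`).
-/

/-! ### A nonnegative function with one-sidedly Lipschitz derivative -/

/-- A positive function whose derivative grows at most with slope `K` satisfies `f'² ≤ 4 K f`:
otherwise a step of length `f' / (2 K)` against the sign of `f'` would make `f` negative. -/
theorem sq_deriv_le_of_pos {f f' : ℝ → ℝ} {K : ℝ} (hK : 0 < K) (hf : ∀ s, HasDerivAt f (f' s) s)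
    (hpos : ∀ s, 0 < f s) (hslope : ∀ s t, s ≤ t → f' t - f' s ≤ K * (t - s)) (s : ℝ) :
    f' s ^ 2 ≤ 4 * K * f s := by
  have hcont : Continuous f := continuous_iff_continuousAt.2 fun x => (hf x).continuousAt
  have key : ∀ t, f t ≤ f s + f' s * (t - s) + K * (t - s) ^ 2 := by
    intro t
    rcases lt_trichotomy s t with h | h | h
    · obtain ⟨c, hc, hc'⟩ := exists_hasDerivAt_eq_slope f f' h hcont.continuousOn fun x _ => hf x
      have h1 := hslope s c hc.1.le
      have h2 : f t - f s = f' c * (t - s) := by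
        rw [hc']; field_simp [sub_ne_zero.2 h.ne']
      have h3 : K * (c - s) ≤ K * (t - s) := by gcongr; exact hc.2.le
      nlinarith [mul_le_mul_of_nonneg_right (h1.trans h3) (sub_nonneg.2 h.le)]
    · simp [h]
    · obtain ⟨c, hc, hc'⟩ := exists_hasDerivAt_eq_slope f f' h hcont.continuousOn fun x _ => hf x
      have h1 := hslope c s hc.2.le
      have h2 : f s - f t = f' c * (s - t) := by
        rw [hc']; field_simp [sub_ne_zero.2 h.ne']
      have h3 : K * (s - c) ≤ K * (s - t) := by gcongr; exact hc.1.le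
      nlinarith [mul_le_mul_of_nonneg_right (h1.trans h3) (sub_nonneg.2 h.le)]
  have h := (hpos _).trans_le (key (s - f' s / (2 * K)))
  have e : f s + f' s * (s - f' s / (2 * K) - s) + K * (s - f' s / (2 * K) - s) ^ 2
      = f s - f' s ^ 2 / (4 * K) := by field_simp; ring
  rw [e, sub_pos, div_lt_iff₀ (by positivity)] at h
  linarith

namespace CahnHilliard

/-! ### Bounds for the nonlinear coefficients -/

/-- The `C¹` regularization of `s log s`, quadratic below `σ`. -/
noncomputable def regEntropy (σ s : ℝ) : ℝ :=
  if σ ≤ s then s * Real.log s else s ^ 2 / (2 * σ) + s * Real.log σ - σ / 2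

/-- The `C⁰` regularization of `log s`, affine below `σ`. -/
noncomputable def regLog (σ s : ℝ) : ℝ := Real.log (max s σ) + s / σ - max s σ / σ

theorem hasDerivAt_regEntropy {σ : ℝ} (hσ : 0 < σ) (s : ℝ) :
    HasDerivAt (regEntropy σ) (regLog σ s + 1) s := by
  have hq : HasDerivAt (fun s => s ^ 2 / (2 * σ) + s * Real.log σ - σ / 2)
      (s / σ + Real.log σ) s := by
    have h := ((((hasDerivAt_id s).pow 2).div_const (2 * σ)).add
      ((hasDerivAt_id s).mul_const (Real.log σ))).sub_const (σ / 2)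
    exact h.congr_deriv (by simp; field_simp)
  have hl : 0 < s → HasDerivAt (fun s => s * Real.log s) (Real.log s + 1) s := fun h =>
    Real.hasDerivAt_mul_log h.ne'
  rcases lt_trichotomy s σ with h | h | h
  · have e : regLog σ s + 1 = s / σ + Real.log σ := by
      rw [regLog, max_eq_right h.le]; field_simp; ring
    rw [e]
    refine hq.congr_of_eventuallyEq ?_
    filter_upwards [Iio_mem_nhds h] with x hx
    rw [regEntropy, if_neg (not_le.2 hx)]
  · subst h
    have e : regLog s s + 1 = Real.log s + 1 := by simp [regLog]
    have e' : s / s + Real.log s = Real.log s + 1 := by field_simp; ring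
    rw [e]
    rw [e'] at hq
    -- the two branches agree to first order at the switching point
    rw [← hasDerivWithinAt_univ, ← Set.Iic_union_Ici (a := s)]
    refine HasDerivWithinAt.union ?_ ?_
    · refine hq.hasDerivWithinAt.congr (fun x hx => ?_) ?_
      · rcases eq_or_lt_of_le (Set.mem_Iic.1 hx) with rfl | hx
        · rw [regEntropy, if_pos le_rfl]; field_simp; ring
        · rw [regEntropy, if_neg (not_le.2 hx)]
      · rw [regEntropy, if_pos le_rfl]; field_simp; ring
    · refine (hl hσ).hasDerivWithinAt.congr (fun x hx => ?_) ?_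
      · rw [regEntropy, if_pos (Set.mem_Ici.1 hx)]
      · rw [regEntropy, if_pos le_rfl]
  · have e : regLog σ s + 1 = Real.log s + 1 := by
      rw [regLog, max_eq_left h.le]; ring
    rw [e]
    refine (hl (hσ.trans h)).congr_of_eventuallyEq ?_
    filter_upwards [Ioi_mem_nhds h] with x hx
    rw [regEntropy, if_pos (Set.mem_Ioi.1 hx).le]

theorem log_sub_log_le {x y : ℝ} (hx : 0 < x) (hy : 0 < y) :
    Real.log y - Real.log x ≤ (y - x) / x := by
  rw [← Real.log_div hy.ne' hx.ne', sub_div, div_self hx.ne']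
  exact Real.log_le_sub_one_of_pos (by positivity)

theorem regLog_slope {σ : ℝ} (hσ : 0 < σ) {s t : ℝ} (h : s ≤ t) :
    regLog σ t - regLog σ s ≤ 1 / σ * (t - s) := by
  have hm : max s σ ≤ max t σ := max_le_max_right σ h
  have h1 := log_sub_log_le (x := max s σ) (y := max t σ) (by positivity) (by positivity)
  have h2 : (max t σ - max s σ) / max s σ ≤ (max t σ - max s σ) / σ :=
    div_le_div_of_nonneg_left (sub_nonneg.2 hm) hσ (le_max_right _ _)
  have e : regLog σ t - regLog σ s = Real.log (max t σ) - Real.log (max s σ)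
      + 1 / σ * (t - s) - (max t σ - max s σ) / σ := by
    unfold regLog; field_simp; ring
  linarith

namespace Params

variable {p : Params}

theorem potential_eq (hp : p.Admissible) (s : ℝ) :
    p.potential s = regEntropy p.σ s + regEntropy p.σ (1 - s) + p.θ * (s - s ^ 2) := by
  have h0 := hp.σ_pos
  have h1 := hp.σ_lt
  unfold potential regEntropy
  by_cases a : 1 - p.σ ≤ s
  · rw [if_pos a, if_pos (by linarith)]
    by_cases b : p.σ ≤ 1 - s
    · have : s = 1 - p.σ := by linarith
      subst this
      rw [if_pos b]
      have e : 1 - (1 - p.σ) = p.σ := by ring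
      rw [e]; field_simp; ring
    · rw [if_neg b]; ring
  · rw [if_neg a]
    by_cases b : p.σ ≤ s
    · rw [if_pos b, if_pos b, if_pos (by linarith)]
    · rw [if_neg b, if_neg b, if_pos (by linarith)]; ring

theorem hasDerivAt_potential (hp : p.Admissible) (s : ℝ) :
    HasDerivAt p.potential (regLog p.σ s - regLog p.σ (1 - s) + p.θ * (1 - 2 * s)) s := by
  have e : p.potential
      = fun s => regEntropy p.σ s + regEntropy p.σ (1 - s) + p.θ * (s - s ^ 2) :=
    funext (potential_eq hp)
  rw [e]
  have h1 := hasDerivAt_regEntropy hp.σ_pos s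
  have h2 := (hasDerivAt_regEntropy hp.σ_pos (1 - s)).comp s ((hasDerivAt_id s).const_sub 1)
  have h3 := (((hasDerivAt_id s).sub ((hasDerivAt_id s).pow 2)).const_mul p.θ)
  exact ((h1.add h2).add h3).congr_deriv (by simp; ring)

/-- `H` is bounded although the potential is only known to be bounded below. -/
theorem H_sq_le (hp : p.Admissible) (s : ℝ) : p.H s ^ 2 ≤ 8 / p.σ := by
  have hσ := hp.σ_pos
  have hB := hp.B_spec s
  have h := sq_deriv_le_of_pos (f := fun s => p.potential s + p.B) (K := 2 / p.σ) (by positivity)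
    (fun s => (hasDerivAt_potential hp s).add_const p.B) hp.B_spec (by
      intro s t hst
      have h1 := regLog_slope hσ hst
      have h2 := regLog_slope hσ (sub_le_sub_left hst 1)
      have h3 : 0 ≤ p.θ * (t - s) := mul_nonneg (by linarith [hp.θ_gt]) (by linarith)
      have e : 2 / p.σ * (t - s) = 1 / p.σ * (t - s) + 1 / p.σ * (1 - s - (1 - t)) := by ring
      rw [e]
      linarith) s
  rw [H, (hasDerivAt_potential hp s).deriv, div_pow, Real.sq_sqrt hB.le, div_le_iff₀ hB]
  calc _ ≤ _ := h
    _ = _ := by ring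

theorem abs_H_le (hp : p.Admissible) (s : ℝ) : |p.H s| ≤ √(8 / p.σ) :=
  Real.abs_le_sqrt (H_sq_le hp s)

theorem measurable_H (hp : p.Admissible) : Measurable p.H := by
  have h : Continuous p.potential :=
    continuous_iff_continuousAt.2 fun x => (hasDerivAt_potential hp x).continuousAt
  exact (measurable_deriv _).div (h.measurable.add_const _).sqrt

theorem measurable_mobility : Measurable p.mobility := by
  unfold mobility
  refine Measurable.ite ?_ (by fun_prop) (by fun_prop)
  exact measurableSet_Icc

theorem le_mobility (hp : p.Admissible) (s : ℝ) : p.σ / 8 ≤ p.mobility s := by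
  have h0 := hp.σ_pos
  have h1 := hp.σ_lt
  unfold mobility
  split_ifs with h
  · have : (2 * s - 1) ^ 2 ≤ 1 := by nlinarith [h.1, h.2]
    nlinarith
  · have := Real.exp_pos (-2 * (1 - p.σ) * ((2 * s - 1) ^ 2 - 1) / p.σ)
    nlinarith

theorem mobility_le (hp : p.Admissible) (s : ℝ) : p.mobility s ≤ 1 / 4 := by
  have h0 := hp.σ_pos
  have h1 := hp.σ_lt
  unfold mobility
  split_ifs with h
  · nlinarith [sq_nonneg (2 * s - 1)]
  · have h2 : 0 ≤ (2 * s - 1) ^ 2 - 1 := by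
      rw [not_and_or, not_le, not_le] at h
      rcases h with h | h <;> nlinarith
    have h3 : Real.exp (-2 * (1 - p.σ) * ((2 * s - 1) ^ 2 - 1) / p.σ) ≤ 1 := by
      rw [Real.exp_le_one_iff]
      refine div_nonpos_of_nonpos_of_nonneg ?_ h0.le
      nlinarith [mul_nonneg (show (0 : ℝ) ≤ 1 - p.σ by linarith) h2]
    nlinarith

theorem mobility_pos (hp : p.Admissible) (s : ℝ) : 0 < p.mobility s :=
  (div_pos hp.σ_pos (by norm_num)).trans_le (le_mobility hp s)

end Params

/-! ### Mollification of weakly differentiable functions -/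

section Mollification

open ContinuousLinearMap (lsmul)
open Filter Topology
open scoped Convolution

variable {d : ℕ}

/-- `g` is the weak gradient of `f` in `Ω`. Both functions are defined on the whole space, and only
their values in `Ω` matter. -/
def HasWeakGrad (Ω : Set (Space d)) (f : Space d → ℝ) (g : Space d → Space d) : Prop :=
  ∀ ζ : Space d → ℝ, ContDiff ℝ ∞ ζ → HasCompactSupport ζ → tsupport ζ ⊆ Ω → ∀ i : Fin d,
    ∫ x, f x * fderiv ℝ ζ x (EuclideanSpace.single i 1) = -∫ x, g x i * ζ x

/-- The convolution of `f` with a normalized smooth bump. -/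
noncomputable def mollify {F : Type*} [NormedAddCommGroup F] [NormedSpace ℝ F]
    (φ : ContDiffBump (0 : Space d)) (f : Space d → F) : Space d → F :=
  φ.normed volume ⋆[lsmul ℝ ℝ, volume] f

theorem mollify_apply {F : Type*} [NormedAddCommGroup F] [NormedSpace ℝ F]
    (φ : ContDiffBump (0 : Space d)) (f : Space d → F) (x : Space d) :
    mollify φ f x = ∫ w, φ.normed volume (x - w) • f w :=
  convolution_lsmul_swap

theorem continuous_mollify {F : Type*} [NormedAddCommGroup F] [NormedSpace ℝ F]
    (φ : ContDiffBump (0 : Space d)) {f : Space d → F} (hf : LocallyIntegrable f) :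
    Continuous (mollify φ f) :=
  φ.hasCompactSupport_normed.continuous_convolution_left _ φ.continuous_normed hf

theorem integrable_bump_smul {F : Type*} [NormedAddCommGroup F] [NormedSpace ℝ F]
    (φ : ContDiffBump (0 : Space d)) {f : Space d → F} (hf : LocallyIntegrable f) (x : Space d) :
    Integrable fun w => φ.normed volume (x - w) • f w := by
  have h := (φ.hasCompactSupport_normed (μ := volume)).convolutionExists_left (lsmul ℝ ℝ)
    φ.continuous_normed hf x
  have := h.integrable_swap
  simpa using! this

/-- Mollification commutes with the weak gradient at points whose distance to the complement of
the domain exceeds the mollification radius. -/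
theorem hasFDerivAt_mollify (φ : ContDiffBump (0 : Space d)) {Ω : Set (Space d)} {f : Space d → ℝ}
    {g : Space d → Space d} (hf : LocallyIntegrable f) (hg : LocallyIntegrable g)
    (h : HasWeakGrad Ω f g) {x : Space d} (hx : Metric.closedBall x φ.rOut ⊆ Ω) :
    HasFDerivAt (mollify φ f) (innerSL ℝ (mollify φ g x)) x := by
  set ρ := φ.normed (volume : Measure (Space d)) with hρ
  have hρd : ContDiff ℝ ∞ ρ := φ.contDiff_normed
  have hρ1 : ContDiff ℝ 1 ρ := hρd.of_le (by simp)
  have h1 := φ.hasCompactSupport_normed.hasFDerivAt_convolution_left (lsmul ℝ ℝ)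
    (μ := volume) hρ1 hf x
  convert! h1 using 1
  -- the test function `w ↦ ρ (x - w)` turns the weak gradient into the mollified one
  set ζ : Space d → ℝ := fun w => ρ (x - w) with hζ
  have hζd : ContDiff ℝ ∞ ζ := hρd.comp (contDiff_const.sub contDiff_id)
  have hsupp : Function.support ζ ⊆ Metric.closedBall x φ.rOut := by
    intro w hw
    have : x - w ∈ Function.support ρ := hw
    rw [hρ, φ.support_normed_eq, mem_ball_zero_iff] at this
    rw [mem_closedBall_iff_norm, norm_sub_rev]
    exact this.le
  have hts : tsupport ζ ⊆ Metric.closedBall x φ.rOut :=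
    closure_minimal hsupp Metric.isClosed_closedBall
  have hζc : HasCompactSupport ζ := HasCompactSupport.of_support_subset_isCompact
    (isCompact_closedBall x φ.rOut) hsupp
  have hζ' : ∀ w, fderiv ℝ ζ w = -fderiv ℝ ρ (x - w) := by
    intro w
    have h2 := ((hρ1.differentiable one_ne_zero) (x - w)).hasFDerivAt.comp w
      ((hasFDerivAt_id w).const_sub x)
    rw [show ζ = ρ ∘ fun w => x - w from rfl, HasFDerivAt.fderiv h2]
    ext v
    simp
  have hint := (φ.hasCompactSupport_normed.fderiv ℝ).convolutionExists_left
    ((lsmul ℝ ℝ : ℝ →L[ℝ] ℝ →L[ℝ] ℝ).precompL (Space d))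
    (hρ1.continuous_fderiv one_ne_zero) hf x
  have hint' := hint.integrable_swap
  have key : ∀ i : Fin d, mollify φ g x i
      = ((fderiv ℝ ρ ⋆[(lsmul ℝ ℝ : ℝ →L[ℝ] ℝ →L[ℝ] ℝ).precompL (Space d), volume] f) x)
        (EuclideanSpace.single i 1) := by
    intro i
    rw [convolution_eq_swap, ContinuousLinearMap.integral_apply hint', mollify_apply]
    have e1 := (EuclideanSpace.proj i : Space d →L[ℝ] ℝ).integral_comp_comm
      (integrable_bump_smul φ hg x)
    have e2 := h ζ hζd hζc (hts.trans hx) i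
    simp only [hζ', neg_apply, mul_neg, integral_neg, neg_inj] at e2
    calc _ = ∫ w, (EuclideanSpace.proj i : Space d →L[ℝ] ℝ) (ρ (x - w) • g w) := e1.symm
      _ = ∫ w, g w i * ζ w := by
        congr 1; ext w; simp [hζ, mul_comm]
      _ = _ := by
        rw [← e2]; congr 1; ext w; simp [ContinuousLinearMap.precompL_apply, mul_comm, hρ]
  refine ContinuousLinearMap.ext fun v => ?_
  rw [← (EuclideanSpace.basisFun (Fin d) ℝ).sum_repr v, map_sum, map_sum]
  refine Finset.sum_congr rfl fun i _ => ?_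
  rw [map_smul, map_smul]
  congr 1
  rw [EuclideanSpace.basisFun_apply, ← key i]
  simp [EuclideanSpace.inner_single_right]

/-- Jensen's inequality for the square. -/
theorem sq_lintegral_le {α : Type*} [MeasurableSpace α] (μ : Measure α) {h : α → ENNReal}
    (hh : AEMeasurable h μ) : (∫⁻ a, h a ∂μ) ^ 2 ≤ μ Set.univ * ∫⁻ a, h a ^ 2 ∂μ := by
  have h1 := ENNReal.lintegral_mul_le_Lp_mul_Lq μ Real.HolderConjugate.two_two
    (aemeasurable_const (b := (1 : ENNReal))) hh
  simp only [Pi.mul_apply, one_mul, ENNReal.one_rpow, lintegral_const] at h1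
  have h2 := pow_le_pow_left' h1 2
  rw [mul_pow] at h2
  simp only [← ENNReal.rpow_natCast, ← ENNReal.rpow_mul] at h2
  norm_num at h2
  exact h2

/-- Mollification does not increase the `L²` norm. -/
theorem lintegral_sq_mollify_le {F : Type*} [NormedAddCommGroup F] [NormedSpace ℝ F]
    (φ : ContDiffBump (0 : Space d)) {f : Space d → F} (hf : AEStronglyMeasurable f) :
    ∫⁻ y, ‖mollify φ f y‖ₑ ^ 2 ≤ ∫⁻ w, ‖f w‖ₑ ^ 2 := by
  set ρ : Space d → ENNReal := fun x => ‖φ.normed volume x‖ₑ with hρ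
  have hρm : Measurable ρ := φ.continuous_normed.measurable.enorm
  have hρ1 : ∫⁻ x, ρ x = 1 := by
    have h1 := φ.integral_normed (μ := volume)
    rw [hρ, ← ofReal_integral_norm_eq_lintegral_enorm φ.integrable_normed]
    simp only [Real.norm_of_nonneg (φ.nonneg_normed _), h1, ENNReal.ofReal_one]
  have hfe := hf.enorm
  have step : ∀ y, ‖mollify φ f y‖ₑ ^ 2 ≤ ∫⁻ w, ρ (y - w) * ‖f w‖ₑ ^ 2 := by
    intro y
    have hm : Measurable fun w => ρ (y - w) := hρm.comp (measurable_const.sub measurable_id)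
    rw [mollify_apply]
    calc _ ≤ (∫⁻ w, ‖φ.normed volume (y - w) • f w‖ₑ) ^ 2 :=
          pow_le_pow_left' (enorm_integral_le_lintegral_enorm _) 2
      _ = (∫⁻ w, ‖f w‖ₑ ∂(volume.withDensity fun w => ρ (y - w))) ^ 2 := by
          rw [lintegral_withDensity_eq_lintegral_mul₀ hm.aemeasurable hfe]
          simp [enorm_smul, hρ]
      _ ≤ _ := sq_lintegral_le _ (hfe.mono_ac (withDensity_absolutelyContinuous _ _))
      _ = _ := by
          rw [lintegral_withDensity_eq_lintegral_mul₀ hm.aemeasurable (hfe.pow_const 2),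
            withDensity_apply _ MeasurableSet.univ, setLIntegral_univ,
            lintegral_sub_left_eq_self ρ y, hρ1, one_mul]
          simp
  calc _ ≤ ∫⁻ y, ∫⁻ w, ρ (y - w) * ‖f w‖ₑ ^ 2 := lintegral_mono step
    _ = ∫⁻ w, ∫⁻ y, ρ (y - w) * ‖f w‖ₑ ^ 2 := by
        refine lintegral_lintegral_swap ?_
        exact ((hρm.comp (measurable_fst.sub measurable_snd)).aemeasurable).mul
          ((hfe.pow_const 2).comp_snd)
    _ = _ := by
        refine lintegral_congr fun w => ?_
        rw [lintegral_mul_const _ (f := fun y => ρ (y - w))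
          (hρm.comp (measurable_id.sub measurable_const)),
          lintegral_sub_right_eq_self ρ w, hρ1, one_mul]

/-- The fundamental theorem of calculus along a segment, for a mollified function. -/
theorem sq_mollify_sub_le (φ : ContDiffBump (0 : Space d)) {Ω : Set (Space d)} {f : Space d → ℝ}
    {g : Space d → Space d} (hf : LocallyIntegrable f) (hg : LocallyIntegrable g)
    (h : HasWeakGrad Ω f g) {x z : Space d}
    (hxz : ∀ y ∈ segment ℝ z x, Metric.closedBall y φ.rOut ⊆ Ω) :
    ‖mollify φ f x - mollify φ f z‖ₑ ^ 2
      ≤ ‖x - z‖ₑ ^ 2 * ∫⁻ t in Set.Ioc (0 : ℝ) 1, ‖mollify φ g (z + t • (x - z))‖ₑ ^ 2 := by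
  have hgc := continuous_mollify φ hg
  have hline : Continuous fun t : ℝ => z + t • (x - z) := by fun_prop
  have hd : ∀ t ∈ Set.uIcc (0 : ℝ) 1, HasDerivAt (fun t : ℝ => mollify φ f (z + t • (x - z)))
      (inner ℝ (mollify φ g (z + t • (x - z))) (x - z)) t := by
    intro t ht
    rw [Set.uIcc_of_le zero_le_one] at ht
    have hy : z + t • (x - z) ∈ segment ℝ z x := by
      rw [segment_eq_image']
      exact ⟨t, ht, rfl⟩
    have h1 : HasDerivAt (fun t : ℝ => z + t • (x - z)) (x - z) t := by
      simpa using ((hasDerivAt_id t).smul_const (x - z)).const_add z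
    exact (hasFDerivAt_mollify φ hf hg h (hxz _ hy)).comp_hasDerivAt t h1
  have hc : Continuous fun t : ℝ => inner ℝ (mollify φ g (z + t • (x - z))) (x - z) :=
    (hgc.comp hline).inner continuous_const
  have hftc := intervalIntegral.integral_eq_sub_of_hasDerivAt hd (hc.intervalIntegrable 0 1)
  simp only [one_smul, zero_smul, add_zero, add_sub_cancel] at hftc
  rw [← hftc, intervalIntegral.integral_of_le zero_le_one]
  have hm : Measurable fun t : ℝ => ‖mollify φ g (z + t • (x - z))‖ₑ :=
    (hgc.comp hline).measurable.enorm
  calc _ ≤ (∫⁻ t in Set.Ioc (0 : ℝ) 1, ‖x - z‖ₑ * ‖mollify φ g (z + t • (x - z))‖ₑ) ^ 2 := by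
        refine pow_le_pow_left' ((enorm_integral_le_lintegral_enorm _).trans
          (lintegral_mono fun t => ?_)) 2
        rw [mul_comm, ← ofReal_norm, ← ofReal_norm, ← ofReal_norm,
          ← ENNReal.ofReal_mul (norm_nonneg _)]
        exact ENNReal.ofReal_le_ofReal (norm_inner_le_norm _ _)
    _ = ‖x - z‖ₑ ^ 2 * (∫⁻ t in Set.Ioc (0 : ℝ) 1, ‖mollify φ g (z + t • (x - z))‖ₑ) ^ 2 := by
        rw [lintegral_const_mul _ hm, mul_pow]
    _ ≤ _ := by
        gcongr
        refine (sq_lintegral_le _ hm.aemeasurable).trans_eq ?_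
        simp

theorem lintegral_comp_smul_add {h : Space d → ENNReal} (hh : Measurable h) {r : ℝ} (hr : r ≠ 0)
    (b : Space d) : ∫⁻ z, h (r • z + b) = ENNReal.ofReal |(r ^ d)⁻¹| * ∫⁻ z, h z := by
  have h1 := lintegral_map (μ := volume) (f := fun z => h (z + b)) (g := fun z : Space d => r • z)
    (hh.comp (measurable_id.add_const b)) (measurable_const_smul r)
  rw [← h1, Measure.map_addHaar_smul _ hr, lintegral_smul_measure, lintegral_add_right_eq_self h b]
  simp

theorem lintegral_comp_smul_add_le {h : Space d → ENNReal} (hh : Measurable h) {r : ℝ}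
    (hr : 1 / 2 ≤ r) (b : Space d) : ∫⁻ z, h (r • z + b) ≤ 2 ^ d * ∫⁻ z, h z := by
  rw [lintegral_comp_smul_add hh (by linarith) b]
  gcongr
  have h2 : (0 : ℝ) < r := by linarith
  rw [abs_of_pos (by positivity), ← inv_pow]
  have h3 : r⁻¹ ≤ 2 := by rw [inv_le_comm₀ h2 two_pos]; linarith
  calc ENNReal.ofReal (r⁻¹ ^ d) ≤ ENNReal.ofReal (2 ^ d) :=
        ENNReal.ofReal_le_ofReal (by gcongr)
    _ = 2 ^ d := by rw [ENNReal.ofReal_pow two_pos.le]; simp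

/-- The integral of `h` along the segment from `z` to `x`, with respect to the parameter in
`[0, 1]`. -/
noncomputable def segmentIntegral (h : Space d → ENNReal) (x z : Space d) : ENNReal :=
  ∫⁻ t in Set.Ioc (0 : ℝ) 1, h (z + t • (x - z))

theorem measurable_segmentIntegral {h : Space d → ENNReal} (hh : Measurable h) :
    Measurable fun q : Space d × Space d => segmentIntegral h q.1 q.2 := by
  refine Measurable.lintegral_prod_right' (f := fun q : (Space d × Space d) × ℝ =>
    h (q.1.2 + q.2 • (q.1.1 - q.1.2))) ?_
  exact hh.comp (by fun_prop)

/-- An integral over all points of all segments between two sets is controlled by the integral over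
the whole space: at least one end point of the segment has a weight `≥ 1/2`, and the change of
variables in this end point costs a factor `≤ 2 ^ d`. -/
theorem lintegral_segment_le (A N : Set (Space d)) {h : Space d → ENNReal} (hh : Measurable h) :
    ∫⁻ x in A, ∫⁻ z in N, segmentIntegral h x z
      ≤ 2 ^ d * (volume A + volume N) * ∫⁻ y, h y := by
  have hm2 : ∀ t : ℝ, Measurable fun q : Space d × Space d => h (q.2 + t • (q.1 - q.2)) := fun t =>
    hh.comp (by fun_prop)
  have e : ∫⁻ x in A, ∫⁻ z in N, segmentIntegral h x z
      = ∫⁻ t in Set.Ioc (0 : ℝ) 1, ∫⁻ x in A, ∫⁻ z in N, h (z + t • (x - z)) := by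
    calc _ = ∫⁻ x in A, ∫⁻ t in Set.Ioc (0 : ℝ) 1, ∫⁻ z in N, h (z + t • (x - z)) :=
          lintegral_congr fun x => lintegral_lintegral_swap (hh.comp (by fun_prop)).aemeasurable
      _ = _ := by
        refine lintegral_lintegral_swap (Measurable.aemeasurable ?_)
        refine Measurable.lintegral_prod_right' (f := fun q : (Space d × ℝ) × Space d =>
          h (q.2 + q.1.2 • (q.1.1 - q.2))) ?_
        exact hh.comp (by fun_prop)
  rw [e]
  have bound : ∀ t ∈ Set.Ioc (0 : ℝ) 1, ∫⁻ x in A, ∫⁻ z in N, h (z + t • (x - z))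
      ≤ 2 ^ d * (volume A + volume N) * ∫⁻ y, h y := by
    intro t ht
    rcases le_total t (1 / 2) with ht' | ht'
    · calc _ ≤ ∫⁻ x in A, 2 ^ d * ∫⁻ y, h y := by
            refine lintegral_mono fun x => (setLIntegral_le_lintegral _ _).trans ?_
            have := lintegral_comp_smul_add_le hh (r := 1 - t) (by linarith) (t • x)
            refine (lintegral_congr fun z => ?_).trans_le this
            congr 1; module
        _ = 2 ^ d * volume A * ∫⁻ y, h y := by
            rw [setLIntegral_const]; ring
        _ ≤ _ := by gcongr; exact le_self_add
    · rw [lintegral_lintegral_swap (hm2 t).aemeasurable]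
      calc _ ≤ ∫⁻ z in N, 2 ^ d * ∫⁻ y, h y := by
            refine lintegral_mono fun z => (setLIntegral_le_lintegral _ _).trans ?_
            have := lintegral_comp_smul_add_le hh (r := t) ht' ((1 - t) • z)
            refine (lintegral_congr fun x => ?_).trans_le this
            congr 1; module
        _ = 2 ^ d * volume N * ∫⁻ y, h y := by
            rw [setLIntegral_const]; ring
        _ ≤ _ := by gcongr; exact le_add_self
  calc _ ≤ ∫⁻ t in Set.Ioc (0 : ℝ) 1, 2 ^ d * (volume A + volume N) * ∫⁻ y, h y :=
        setLIntegral_mono measurable_const bound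
    _ = _ := by simp

/-- Mollifiers with radii tending to zero converge almost everywhere. -/
theorem exists_mollifiers {f : Space d → ℝ} (hf : LocallyIntegrable f) :
    ∃ φ : ℕ → ContDiffBump (0 : Space d), Tendsto (fun k => (φ k).rOut) atTop (𝓝 0) ∧
      ∀ᵐ x, Tendsto (fun k => mollify (φ k) f x) atTop (𝓝 (f x)) := by
  have hpos : ∀ k : ℕ, (0 : ℝ) < 1 / ((k : ℝ) + 1) := fun k => by positivity
  let φ : ℕ → ContDiffBump (0 : Space d) := fun k =>
    ⟨1 / ((k : ℝ) + 1), 2 * (1 / ((k : ℝ) + 1)), hpos k, by linarith [hpos k]⟩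
  have hφ0 : Tendsto (fun k => (φ k).rOut) atTop (𝓝 0) := by
    have := (tendsto_one_div_add_atTop_nhds_zero_nat (𝕜 := ℝ)).const_mul 2
    rwa [mul_zero] at this
  exact ⟨φ, hφ0, ContDiffBump.ae_convolution_tendsto_right_of_locallyIntegrable (K := 2) hφ0
    (Eventually.of_forall fun k => le_refl _) hf⟩

theorem sq_sub_le_liminf {Ω : Set (Space d)} (hΩ : IsOpen Ω) {f : Space d → ℝ}
    {g : Space d → Space d} (hf : LocallyIntegrable f) (hg : LocallyIntegrable g)
    (h : HasWeakGrad Ω f g) {φ : ℕ → ContDiffBump (0 : Space d)}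
    (hφ0 : Tendsto (fun k => (φ k).rOut) atTop (𝓝 0)) {x z : Space d}
    (hx : Tendsto (fun k => mollify (φ k) f x) atTop (𝓝 (f x)))
    (hz : Tendsto (fun k => mollify (φ k) f z) atTop (𝓝 (f z))) (hxz : segment ℝ z x ⊆ Ω) :
    ‖f x - f z‖ₑ ^ 2 ≤ ‖x - z‖ₑ ^ 2 *
      liminf (fun k => segmentIntegral (fun y => ‖mollify (φ k) g y‖ₑ ^ 2) x z) atTop := by
  have h1 : Tendsto (fun k => ‖mollify (φ k) f x - mollify (φ k) f z‖ₑ ^ 2) atTop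
      (𝓝 (‖f x - f z‖ₑ ^ 2)) :=
    ((ENNReal.continuous_pow 2).tendsto _).comp (hx.sub hz).enorm
  rw [← h1.liminf_eq, ← ENNReal.liminf_const_mul_of_ne_top (by finiteness)]
  refine liminf_le_liminf ?_
  -- a whole neighbourhood of the segment lies in `Ω`
  have hc : IsCompact (segment ℝ z x) := by
    rw [segment_eq_image']
    exact isCompact_Icc.image (by fun_prop)
  obtain ⟨δ, hδ, hδΩ⟩ := hc.exists_cthickening_subset_open hΩ hxz
  filter_upwards [hφ0.eventually_lt_const hδ] with k hk
  exact sq_mollify_sub_le (φ k) hf hg h fun y hy =>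
    (Metric.closedBall_subset_closedBall hk.le).trans
      ((Metric.closedBall_subset_cthickening hy δ).trans hδΩ)

/-- Fatou's lemma for iterated integrals. -/
theorem lintegral_lintegral_le_of_le_liminf {α β : Type*} [MeasurableSpace α] [MeasurableSpace β]
    {μ : Measure α} {ν : Measure β} [SFinite ν] {F : α → β → ENNReal} {J : ℕ → α → β → ENNReal}
    {c M : ENNReal} (hJ : ∀ k, Measurable fun q : α × β => J k q.1 q.2)
    (hF : ∀ᵐ x ∂μ, ∀ᵐ z ∂ν, F x z ≤ c * liminf (fun k => J k x z) atTop)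
    (hM : ∀ k, ∫⁻ x, ∫⁻ z, J k x z ∂ν ∂μ ≤ M) : ∫⁻ x, ∫⁻ z, F x z ∂ν ∂μ ≤ c * M := by
  have h1 : ∀ k x, Measurable (J k x) := fun k x => (hJ k).comp measurable_prodMk_left
  have h0 : ∀ k, Measurable fun x => ∫⁻ z, J k x z ∂ν := fun k => (hJ k).lintegral_prod_right'
  have l2 : Measurable fun q : α × β => liminf (fun k => J k q.1 q.2) atTop := Measurable.liminf hJ
  have l1 : ∀ x, Measurable fun z => liminf (fun k => J k x z) atTop := fun x =>
    Measurable.liminf fun k => h1 k x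
  have l0 : Measurable fun x => ∫⁻ z, liminf (fun k => J k x z) atTop ∂ν :=
    Measurable.lintegral_prod_right' l2
  calc ∫⁻ x, ∫⁻ z, F x z ∂ν ∂μ
      ≤ ∫⁻ x, ∫⁻ z, c * liminf (fun k => J k x z) atTop ∂ν ∂μ :=
        lintegral_mono_ae (hF.mono fun x hx => lintegral_mono_ae hx)
    _ = c * ∫⁻ x, ∫⁻ z, liminf (fun k => J k x z) atTop ∂ν ∂μ := by
        simp_rw [lintegral_const_mul _ (l1 _)]
        exact lintegral_const_mul _ l0
    _ ≤ c * liminf (fun k => ∫⁻ x, ∫⁻ z, J k x z ∂ν ∂μ) atTop := by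
        refine mul_le_mul_right ?_ _
        exact (lintegral_mono fun x => lintegral_liminf_le fun k => h1 k x).trans
          (lintegral_liminf_le h0)
    _ ≤ c * M := by
        refine mul_le_mul_right ?_ _
        exact liminf_le_of_frequently_le' (Frequently.of_forall hM)

/-- **Local Poincaré inequality** for two sets that see each other inside `Ω`: the mean square
oscillation between them is controlled by the weak gradient. -/
theorem lintegral_sq_sub_le {Ω : Set (Space d)} (hΩ : IsOpen Ω) {f : Space d → ℝ}
    {g : Space d → Space d} (hf : LocallyIntegrable f) (hg : LocallyIntegrable g)
    (h : HasWeakGrad Ω f g) {A N : Set (Space d)} (hA : MeasurableSet A) (hN : MeasurableSet N)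
    (hvis : ∀ x ∈ A, ∀ z ∈ N, segment ℝ z x ⊆ Ω) {D : ENNReal}
    (hD : ∀ x ∈ A, ∀ z ∈ N, ‖x - z‖ₑ ≤ D) :
    ∫⁻ x in A, ∫⁻ z in N, ‖f x - f z‖ₑ ^ 2
      ≤ D ^ 2 * (2 ^ d * (volume A + volume N) * ∫⁻ y, ‖g y‖ₑ ^ 2) := by
  obtain ⟨φ, hφ0, hae⟩ := exists_mollifiers hf
  have hgm : ∀ k, Measurable fun y => ‖mollify (φ k) g y‖ₑ ^ 2 := fun k =>
    (continuous_mollify (φ k) hg).measurable.enorm.pow_const 2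
  refine lintegral_lintegral_le_of_le_liminf
    (J := fun k => segmentIntegral fun y => ‖mollify (φ k) g y‖ₑ ^ 2)
    (fun k => measurable_segmentIntegral (hgm k)) ?_ fun k => ?_
  · rw [ae_restrict_iff' hA]
    filter_upwards [hae] with x hx hxA
    rw [ae_restrict_iff' hN]
    filter_upwards [hae] with z hz hzN
    exact (sq_sub_le_liminf hΩ hf hg h hφ0 hx hz (hvis x hxA z hzN)).trans
      (mul_le_mul_left (pow_le_pow_left' (hD x hxA z hzN) 2) _)
  · exact (lintegral_segment_le A N (hgm k)).trans
      (mul_le_mul_right (lintegral_sq_mollify_le (φ k) hg.aestronglyMeasurable) _)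

end Mollification

/-! ### The Poincaré inequality -/

section Poincare

open Filter Topology

variable {d : ℕ}

/-- The mean square oscillation of weakly differentiable functions between `A` and `N` is
controlled by the weak gradient in `Ω`. -/
def Linked (Ω A N : Set (Space d)) : Prop :=
  ∃ C : ENNReal, C ≠ ⊤ ∧ ∀ (f : Space d → ℝ) (g : Space d → Space d), Measurable f →
    LocallyIntegrable f → LocallyIntegrable g → HasWeakGrad Ω f g →
    ∫⁻ x in A, ∫⁻ z in N, ‖f x - f z‖ₑ ^ 2 ≤ C * ∫⁻ y, ‖g y‖ₑ ^ 2

theorem measurable_sq_sub {f : Space d → ℝ} (hf : Measurable f) :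
    Measurable fun q : Space d × Space d => ‖f q.1 - f q.2‖ₑ ^ 2 :=
  ((hf.comp measurable_fst).sub (hf.comp measurable_snd)).enorm.pow_const 2

theorem Linked.mono {Ω A A' N N' : Set (Space d)} (h : Linked Ω A N) (hA : A' ⊆ A)
    (hN : N' ⊆ N) : Linked Ω A' N' := by
  obtain ⟨C, hC, h⟩ := h
  refine ⟨C, hC, fun f g h1 h2 h3 h4 => le_trans ?_ (h f g h1 h2 h3 h4)⟩
  exact (lintegral_mono_set hA).trans (lintegral_mono fun x => lintegral_mono_set hN)

theorem Linked.symm {Ω A N : Set (Space d)} (h : Linked Ω A N) : Linked Ω N A := by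
  obtain ⟨C, hC, h⟩ := h
  refine ⟨C, hC, fun f g h1 h2 h3 h4 => le_trans (le_of_eq ?_) (h f g h1 h2 h3 h4)⟩
  rw [lintegral_lintegral_swap (measurable_sq_sub h1).aemeasurable]
  refine lintegral_congr fun x => lintegral_congr fun z => ?_
  rw [← enorm_neg, neg_sub]

theorem Linked.of_visible {Ω A N : Set (Space d)} (hΩ : IsOpen Ω) (hb : Bornology.IsBounded Ω)
    (hA : MeasurableSet A) (hN : MeasurableSet N) (hAΩ : A ⊆ Ω) (hNΩ : N ⊆ Ω)
    (hvis : ∀ x ∈ A, ∀ z ∈ N, segment ℝ z x ⊆ Ω) : Linked Ω A N := by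
  have hA' : volume A ≠ ⊤ := (hb.subset hAΩ).measure_lt_top.ne
  have hN' : volume N ≠ ⊤ := (hb.subset hNΩ).measure_lt_top.ne
  have hD : Metric.ediam Ω ≠ ⊤ := hb.ediam_ne_top
  refine ⟨Metric.ediam Ω ^ 2 * (2 ^ d * (volume A + volume N)), by finiteness,
    fun f g _ h2 h3 h4 => ?_⟩
  rw [mul_assoc]
  refine lintegral_sq_sub_le hΩ h2 h3 h4 hA hN hvis fun x hx z hz => ?_
  rw [← edist_eq_enorm_sub]
  exact Metric.edist_le_ediam_of_mem (hAΩ hx) (hNΩ hz)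

theorem Linked.trans {Ω A P N : Set (Space d)} (h1 : Linked Ω A P) (h2 : Linked Ω P N)
    (hA : volume A ≠ ⊤) (hN : volume N ≠ ⊤) (hP0 : volume P ≠ 0) (hP : volume P ≠ ⊤) :
    Linked Ω A N := by
  obtain ⟨C₁, hC₁, h1⟩ := h1
  obtain ⟨C₂, hC₂, h2⟩ := h2
  refine ⟨(volume P)⁻¹ * (2 * (volume N * C₁ + volume A * C₂)), by finiteness,
    fun f g m1 m2 m3 m4 => ?_⟩
  have hm := measurable_sq_sub m1
  have hmx : ∀ x, Measurable fun y => ‖f x - f y‖ₑ ^ 2 := fun x =>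
    (measurable_const.sub m1).enorm.pow_const 2
  have hmy : ∀ z, Measurable fun y => ‖f y - f z‖ₑ ^ 2 := fun z =>
    (m1.sub measurable_const).enorm.pow_const 2
  have hab : ∀ x z, Measurable fun y => ‖f x - f y‖ₑ ^ 2 + ‖f y - f z‖ₑ ^ 2 := fun x z =>
    (hmx x).add (hmy z)
  have e : ∀ a : ℝ, ‖a‖ₑ ^ 2 = ENNReal.ofReal (a ^ 2) := fun a => by
    rw [← ofReal_norm, ← ENNReal.ofReal_pow (norm_nonneg _), Real.norm_eq_abs, sq_abs]
  have tri : ∀ x y z, ‖f x - f z‖ₑ ^ 2 ≤ 2 * (‖f x - f y‖ₑ ^ 2 + ‖f y - f z‖ₑ ^ 2) := by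
    intro x y z
    rw [e, e, e, ← ENNReal.ofReal_add (sq_nonneg _) (sq_nonneg _),
      show (2 : ENNReal) = ENNReal.ofReal 2 by simp, ← ENNReal.ofReal_mul two_pos.le]
    refine ENNReal.ofReal_le_ofReal ?_
    nlinarith [sq_nonneg (f x - f y - (f y - f z))]
  set a : Space d → ENNReal := fun x => ∫⁻ y in P, ‖f x - f y‖ₑ ^ 2 with ha
  set b : Space d → ENNReal := fun z => ∫⁻ y in P, ‖f y - f z‖ₑ ^ 2 with hb
  have ham : Measurable a := hm.lintegral_prod_right'
  have hbm : Measurable b := hm.lintegral_prod_left'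
  have point : ∀ x z, ‖f x - f z‖ₑ ^ 2 ≤ (volume P)⁻¹ * 2 * (a x + b z) := by
    intro x z
    have h : ∫⁻ y in P, ‖f x - f z‖ₑ ^ 2 ≤ 2 * (a x + b z) := by
      rw [ha, hb, ← lintegral_add_left (hmx x),
        ← lintegral_const_mul _ (hab x z)]
      exact lintegral_mono fun y => tri x y z
    rw [setLIntegral_const] at h
    rwa [mul_assoc, ← ENNReal.div_eq_inv_mul, ENNReal.le_div_iff_mul_le (.inl hP0) (.inl hP)]
  have hasum : ∫⁻ x in A, a x ≤ C₁ * ∫⁻ y, ‖g y‖ₑ ^ 2 := h1 f g m1 m2 m3 m4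
  have hbsum : ∫⁻ z in N, b z ≤ C₂ * ∫⁻ y, ‖g y‖ₑ ^ 2 := by
    refine le_trans (le_of_eq ?_) (h2 f g m1 m2 m3 m4)
    exact (lintegral_lintegral_swap (f := fun y z => ‖f y - f z‖ₑ ^ 2) hm.aemeasurable).symm
  calc ∫⁻ x in A, ∫⁻ z in N, ‖f x - f z‖ₑ ^ 2
      ≤ ∫⁻ x in A, ∫⁻ z in N, (volume P)⁻¹ * 2 * (a x + b z) :=
        lintegral_mono fun x => lintegral_mono fun z => point x z
    _ = (volume P)⁻¹ * 2 * (volume N * (∫⁻ x in A, a x) + volume A * ∫⁻ z in N, b z) := by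
        have hin : ∀ x, ∫⁻ z in N, (volume P)⁻¹ * 2 * (a x + b z)
            = (volume P)⁻¹ * 2 * (volume N * a x + ∫⁻ z in N, b z) := fun x => by
          have h : Measurable fun z => a x + b z := measurable_const.add hbm
          rw [lintegral_const_mul _ h, lintegral_add_left measurable_const, setLIntegral_const,
            mul_comm (a x)]
        have h : Measurable fun x => volume N * a x + ∫⁻ z in N, b z :=
          (ham.const_mul _).add_const _
        simp_rw [hin]
        rw [lintegral_const_mul _ h,
          lintegral_add_right _ measurable_const, lintegral_const_mul _ ham, setLIntegral_const,
          mul_comm (volume A)]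
    _ ≤ (volume P)⁻¹ * 2 * (volume N * (C₁ * ∫⁻ y, ‖g y‖ₑ ^ 2)
          + volume A * (C₂ * ∫⁻ y, ‖g y‖ₑ ^ 2)) := by
        refine mul_le_mul_right (add_le_add ?_ ?_) _
        · exact mul_le_mul_right hasum _
        · exact mul_le_mul_right hbsum _
    _ = _ := by ring

theorem Linked.union {Ω A A' N : Set (Space d)} (h : Linked Ω A N) (h' : Linked Ω A' N) :
    Linked Ω (A ∪ A') N := by
  obtain ⟨C, hC, h⟩ := h
  obtain ⟨C', hC', h'⟩ := h'
  refine ⟨C + C', by finiteness, fun f g h1 h2 h3 h4 => ?_⟩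
  rw [add_mul]
  exact (lintegral_union_le _ _ _).trans (add_le_add (h f g h1 h2 h3 h4) (h' f g h1 h2 h3 h4))

theorem Linked.biUnion {Ω N : Set (Space d)} {ι : Type*} {t : Set ι} (ht : t.Finite)
    {A : ι → Set (Space d)} (h : ∀ i ∈ t, Linked Ω (A i) N) : Linked Ω (⋃ i ∈ t, A i) N := by
  induction t, ht using Set.Finite.induction_on with
  | empty => exact ⟨0, by simp, by simp⟩
  | insert _ _ ih =>
    rw [Set.biUnion_insert]
    exact (h _ (Set.mem_insert _ _)).union (ih fun i hi => h i (Set.mem_insert_of_mem _ hi))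

/-- Mean-zero functions on a domain that is linked to itself satisfy the Poincaré inequality. -/
theorem Linked.poincare {Ω : Set (Space d)} (h : Linked Ω Ω Ω) (h0 : volume Ω ≠ 0)
    (hfin : volume Ω ≠ ⊤) : ∃ C : ENNReal, C ≠ ⊤ ∧ ∀ (f : Space d → ℝ) (g : Space d → Space d),
      Measurable f → IntegrableOn f Ω → LocallyIntegrable f → LocallyIntegrable g →
      HasWeakGrad Ω f g → ∫ x in Ω, f x = 0 →
      ∫⁻ x in Ω, ‖f x‖ₑ ^ 2 ≤ C * ∫⁻ y, ‖g y‖ₑ ^ 2 := by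
  obtain ⟨C, hC, h⟩ := h
  refine ⟨(volume Ω)⁻¹ * C, by finiteness, fun f g h1 hi h2 h3 h4 hz => ?_⟩
  have : IsFiniteMeasure (volume.restrict Ω) := ⟨by simpa using hfin.lt_top⟩
  have hm := measurable_sq_sub h1
  have point : ∀ x, ‖f x‖ₑ ^ 2 ≤ (volume Ω)⁻¹ * ∫⁻ z in Ω, ‖f x - f z‖ₑ ^ 2 := by
    intro x
    have e : ∫ z in Ω, (f x - f z) = volume.real Ω * f x := by
      rw [integral_sub (integrable_const _) hi, hz, sub_zero]
      simp
    have e1 : volume Ω * ‖f x‖ₑ ≤ ∫⁻ z in Ω, ‖f x - f z‖ₑ := by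
      refine le_trans (le_of_eq ?_) (enorm_integral_le_lintegral_enorm _)
      rw [e, enorm_mul]
      congr 1
      rw [Real.enorm_of_nonneg measureReal_nonneg, measureReal_def, ENNReal.ofReal_toReal hfin]
    have e2 := (pow_le_pow_left' e1 2).trans
      (sq_lintegral_le (volume.restrict Ω) (measurable_const.sub h1).enorm.aemeasurable)
    rw [Measure.restrict_apply_univ, mul_pow, sq (volume Ω), mul_assoc,
      ENNReal.mul_le_mul_iff_right h0 hfin] at e2
    rwa [← ENNReal.div_eq_inv_mul, ENNReal.le_div_iff_mul_le (.inl h0) (.inl hfin), mul_comm]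
  calc _ ≤ ∫⁻ x in Ω, (volume Ω)⁻¹ * ∫⁻ z in Ω, ‖f x - f z‖ₑ ^ 2 := lintegral_mono point
    _ = (volume Ω)⁻¹ * ∫⁻ x in Ω, ∫⁻ z in Ω, ‖f x - f z‖ₑ ^ 2 :=
        lintegral_const_mul _ hm.lintegral_prod_right'
    _ ≤ _ := by
        rw [mul_assoc]
        exact mul_le_mul_right (h f g h1 h2 h3 h4) _

/-- In a connected open set, every point has a neighbourhood linked to a fixed ball: the points with
this property form an open and relatively closed set. -/
theorem exists_ball_linked {Ω : Set (Space d)} (hΩ : IsOpen Ω) (hc : IsPreconnected Ω)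
    (hb : Bornology.IsBounded Ω) {x₀ : Space d} {r₀ : ℝ} (hr₀ : 0 < r₀)
    (h₀ : Metric.ball x₀ r₀ ⊆ Ω) {y : Space d} (hy : y ∈ Ω) :
    ∃ ρ > 0, Metric.ball y ρ ⊆ Ω ∧ Linked Ω (Metric.ball y ρ) (Metric.ball x₀ r₀) := by
  have hconv : ∀ y ρ, Metric.ball y ρ ⊆ Ω → ∀ P ⊆ Metric.ball y ρ, MeasurableSet P →
      Linked Ω (Metric.ball y ρ) P := fun y ρ hyρ P hP hPm =>
    Linked.of_visible hΩ hb measurableSet_ball hPm hyρ (hP.trans hyρ) fun x hx z hz =>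
      ((convex_ball y ρ).segment_subset (hP hz) hx).trans hyρ
  have hfin : ∀ y ρ, volume (Metric.ball y ρ : Set (Space d)) ≠ ⊤ := fun y ρ =>
    measure_ball_lt_top.ne
  let S : Set (Space d) := {y | ∃ ρ > 0, Metric.ball y ρ ⊆ Ω ∧
    Linked Ω (Metric.ball y ρ) (Metric.ball x₀ r₀)}
  suffices Ω ⊆ S from this hy
  refine hc.subset_of_closure_inter_subset ?_ ?_ ?_
  · rw [Metric.isOpen_iff]
    rintro y ⟨ρ, hρ, h1, h2⟩
    refine ⟨ρ, hρ, fun y' hy' => ?_⟩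
    obtain ⟨ρ', hρ', h3⟩ := Metric.isOpen_iff.1 Metric.isOpen_ball y' hy'
    exact ⟨ρ', hρ', h3.trans h1, h2.mono h3 subset_rfl⟩
  · exact ⟨x₀, h₀ (Metric.mem_ball_self hr₀), r₀, hr₀, h₀, hconv _ _ h₀ _ subset_rfl
      measurableSet_ball⟩
  · rintro y ⟨hyS, hyΩ⟩
    obtain ⟨ρ, hρ, h1⟩ := Metric.isOpen_iff.1 hΩ y hyΩ
    obtain ⟨y', ⟨ρ', hρ', -, h2⟩, hyy'⟩ := Metric.mem_closure_iff.1 hyS ρ hρ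
    have hP : IsOpen (Metric.ball y ρ ∩ Metric.ball y' ρ') :=
      Metric.isOpen_ball.inter Metric.isOpen_ball
    have hPn : (Metric.ball y ρ ∩ Metric.ball y' ρ').Nonempty :=
      ⟨y', by rwa [Metric.mem_ball'], Metric.mem_ball_self hρ'⟩
    exact ⟨ρ, hρ, h1, (hconv y ρ h1 _ Set.inter_subset_left hP.measurableSet).trans
      (h2.mono Set.inter_subset_right subset_rfl) (hfin _ _) (hfin _ _)
      (hP.measure_pos volume hPn).ne'
      ((measure_mono Set.inter_subset_left).trans_lt measure_ball_lt_top).ne⟩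

/-- The points from which a compact set is visible inside an open set form an open set. -/
theorem isOpen_setOf_segment_subset {Ω K : Set (Space d)} (hΩ : IsOpen Ω) (hK : IsCompact K) :
    IsOpen {x | ∀ z ∈ K, segment ℝ z x ⊆ Ω} := by
  rw [isOpen_iff_mem_nhds]
  intro x hx
  have h := (hK.prod (isCompact_Icc (a := (0 : ℝ)) (b := 1))).eventually_forall_of_forall_eventually
    (x₀ := x) (P := fun x q => q.1 + q.2 • (x - q.1) ∈ Ω) (by
      rintro ⟨z, t⟩ ⟨hz, ht⟩
      have hc : Continuous fun w : Space d × Space d × ℝ => w.2.1 + w.2.2 • (w.1 - w.2.1) := by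
        fun_prop
      refine hc.continuousAt.eventually (hΩ.mem_nhds (hx z hz ?_))
      rw [segment_eq_image']
      exact ⟨t, ht, rfl⟩)
  filter_upwards [h] with x' hx' z hz
  rw [segment_eq_image']
  rintro _ ⟨t, ht, rfl⟩
  exact hx' (z, t) ⟨hz, ht⟩

/-- A cone domain is linked to itself: by the cone property it is the union of finitely many sets,
each of which sees some ball, and these balls are linked because the domain is connected. -/
theorem IsConeDomain.linked {Ω : Set (Space d)} (h : IsConeDomain Ω) : Linked Ω Ω Ω := by
  have hΩ := h.isOpen
  have hb := h.isBounded
  have hΩfin : volume Ω ≠ ⊤ := hb.measure_lt_top.ne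
  obtain ⟨x₀, hx₀⟩ := h.isConnected.nonempty
  obtain ⟨r₀, hr₀, h₀⟩ := Metric.isOpen_iff.1 hΩ x₀ hx₀
  obtain ⟨r, hr, hcone⟩ := h.cone
  set K : Set (Space d) := {y | Metric.ball y r ⊆ Ω}
  have hKΩ : K ⊆ Ω := fun y hy => hy (Metric.mem_ball_self hr)
  obtain ⟨t, htK, htf, hKt⟩ := ((hb.subset hKΩ).isCompact_closure.totallyBounded.subset
    subset_closure).exists_subset
    (Metric.dist_mem_uniformity (half_pos hr))
  set A : Space d → Set (Space d) := fun y =>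
    {x | ∀ z ∈ Metric.closedBall y (r / 2), segment ℝ z x ⊆ Ω} with hA
  have hAΩ : ∀ y, A y ⊆ Ω := fun y x hx =>
    hx y (Metric.mem_closedBall_self (half_pos hr).le) (right_mem_segment ℝ y x)
  have hcover : Ω ⊆ ⋃ y ∈ t, A y := by
    intro x hx
    obtain ⟨y', hy'⟩ := hcone x hx
    have hy'K : y' ∈ K := fun w hw => hy' (subset_convexHull ℝ _ (Set.mem_insert_of_mem _ hw))
    obtain ⟨y, hyt, hyy'⟩ := Set.mem_iUnion₂.1 (hKt hy'K)
    refine Set.mem_iUnion₂.2 ⟨y, hyt, fun z hz => ?_⟩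
    have hz' : z ∈ Metric.ball y' r := by
      have hyy' : dist y' y < r / 2 := hyy'
      rw [Metric.mem_ball]
      rw [Metric.mem_closedBall] at hz
      have := dist_triangle z y y'
      rw [dist_comm y y'] at this
      linarith
    exact ((convex_convexHull ℝ _).segment_subset
      (subset_convexHull ℝ _ (Set.mem_insert_of_mem _ hz'))
      (subset_convexHull ℝ _ (Set.mem_insert _ _))).trans hy'
  have hlink : ∀ y ∈ t, Linked Ω (A y) (Metric.ball x₀ r₀) := by
    intro y hy
    obtain ⟨ρ, hρ, h1, h2⟩ := exists_ball_linked hΩ h.isConnected.isPreconnected hb hr₀ h₀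
      (hKΩ (htK hy))
    have hρ' : 0 < min ρ (r / 2) := lt_min hρ (half_pos hr)
    have hs : Metric.ball y (min ρ (r / 2)) ⊆ Metric.ball y ρ :=
      Metric.ball_subset_ball (min_le_left _ _)
    have h3 : Linked Ω (A y) (Metric.ball y (min ρ (r / 2))) :=
      Linked.of_visible hΩ hb
        (isOpen_setOf_segment_subset hΩ (isCompact_closedBall y (r / 2))).measurableSet
        measurableSet_ball (hAΩ y) (hs.trans h1) fun x hx z hz =>
          hx z (Metric.ball_subset_closedBall (Metric.ball_subset_ball (min_le_right _ _) hz))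
    exact h3.trans (h2.mono hs subset_rfl) ((measure_mono (hAΩ y)).trans_lt hΩfin.lt_top).ne
      measure_ball_lt_top.ne (Metric.measure_ball_pos volume y hρ').ne' measure_ball_lt_top.ne
  have h4 : Linked Ω Ω (Metric.ball x₀ r₀) :=
    (Linked.biUnion htf hlink).mono hcover subset_rfl
  exact h4.trans h4.symm hΩfin hΩfin (Metric.measure_ball_pos volume x₀ hr₀).ne'
    measure_ball_lt_top.ne

end Poincare

/-! ### Periodic functions on a box -/

section Periodic

open Filter Topology

variable {d : ℕ}

/-- The point of the half-open box `∏ᵢ [0, Lᵢ)` that is congruent to `x` modulo the periods. -/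
noncomputable def wrap (L : Fin d → ℝ) (x : Space d) : Space d :=
  WithLp.toLp 2 fun i => L i * Int.fract (x i / L i)

theorem wrap_add_single {L : Fin d → ℝ} (hL : ∀ i, 0 < L i) (x : Space d) (i : Fin d) :
    wrap L (x + EuclideanSpace.single i (L i)) = wrap L x := by
  unfold wrap
  congr 1
  funext j
  by_cases h : j = i
  · subst h
    simp [add_div, (hL j).ne']
  · simp [h]

theorem wrap_eq_self {L : Fin d → ℝ} (hL : ∀ i, 0 < L i) {x : Space d}
    (hx : ∀ i, x i ∈ Set.Ioo 0 (L i)) : wrap L x = x := by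
  ext i
  have h1 : Int.fract (x i / L i) = x i / L i :=
    Int.fract_eq_self.2 ⟨(div_pos (hx i).1 (hL i)).le, (div_lt_one (hL i)).2 (hx i).2⟩
  change L i * Int.fract (x i / L i) = x i
  rw [h1, mul_div_cancel₀ _ (hL i).ne']

theorem isOpen_box (L : Fin d → ℝ) : IsOpen {x : Space d | ∀ i, x i ∈ Set.Ioo 0 (L i)} := by
  simp only [Set.ofPred_forall]
  exact isOpen_iInter_of_finite fun i => isOpen_Ioo.preimage (by fun_prop)

theorem convex_box (L : Fin d → ℝ) : Convex ℝ {x : Space d | ∀ i, x i ∈ Set.Ioo 0 (L i)} := by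
  simp only [Set.ofPred_forall]
  exact convex_iInter fun i => (convex_Ioo 0 (L i)).linear_preimage
    (EuclideanSpace.proj i : Space d →L[ℝ] ℝ).toLinearMap

theorem box_nonempty {L : Fin d → ℝ} (hL : ∀ i, 0 < L i) :
    {x : Space d | ∀ i, x i ∈ Set.Ioo 0 (L i)}.Nonempty :=
  ⟨WithLp.toLp 2 fun i => L i / 2, fun i => ⟨half_pos (hL i), half_lt_self (hL i)⟩⟩

/-- A compact subset of the box keeps a positive distance to its faces. -/
theorem exists_margin {L : Fin d → ℝ} {K : Set (Space d)} (hK : IsCompact K)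
    (hKL : K ⊆ {x | ∀ i, x i ∈ Set.Ioo 0 (L i)}) :
    ∃ δ > 0, ∀ x ∈ K, ∀ i, δ < x i ∧ x i < L i - δ := by
  obtain ⟨δ, hδ, h⟩ := hK.exists_cthickening_subset_open (isOpen_box L) hKL
  refine ⟨δ, hδ, fun x hx i => ?_⟩
  have hball := (Metric.closedBall_subset_cthickening hx δ).trans h
  have h1 : x + EuclideanSpace.single i δ ∈ Metric.closedBall x δ := by
    simp [abs_of_pos hδ]
  have h2 : x - EuclideanSpace.single i δ ∈ Metric.closedBall x δ := by
    simp [abs_of_pos hδ]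
  have h3 := (hball h1 i).2
  have h4 := (hball h2 i).1
  simp at h3 h4
  exact ⟨h4, by linarith⟩

/-- The periodic extension of a smooth function with compact support in the box is smooth. -/
theorem contDiff_comp_wrap {L : Fin d → ℝ} (hL : ∀ i, 0 < L i) {ζ : Space d → ℝ}
    (hζ : ContDiff ℝ ∞ ζ) (hc : HasCompactSupport ζ)
    (hs : tsupport ζ ⊆ {x | ∀ i, x i ∈ Set.Ioo 0 (L i)}) :
    ContDiff ℝ ∞ fun x => ζ (wrap L x) := by
  obtain ⟨δ, hδ, hmargin⟩ := exists_margin hc.isCompact hs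
  rw [contDiff_iff_contDiffAt]
  intro x
  by_cases hx : ∃ i, ∃ k : ℤ, x i = L i * k
  · -- near the faces of the lattice cells the extension vanishes
    obtain ⟨i, k, hk⟩ := hx
    have hnear : ∀ᶠ y in 𝓝 x, y i ∈ Set.Ioo (x i - δ) (x i + δ) := by
      have hcont : Continuous fun y : Space d => y i := by fun_prop
      exact hcont.continuousAt.eventually (Ioo_mem_nhds (by linarith) (by linarith))
    refine contDiffAt_const (c := (0 : ℝ)) |>.congr_of_eventuallyEq ?_
    filter_upwards [hnear] with y hy
    by_contra hne
    obtain ⟨h1, h2⟩ := hmargin _ (subset_tsupport ζ hne) i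
    have e : wrap L y i = y i - L i * ⌊y i / L i⌋ := by
      change L i * Int.fract (y i / L i) = _
      rw [Int.fract, mul_sub, mul_div_cancel₀ _ (hL i).ne']
    rw [e] at h1 h2
    rw [hk] at hy
    obtain ⟨h3, h4⟩ := hy
    have h5 : (⌊y i / L i⌋ : ℝ) < k := lt_of_mul_lt_mul_left (a := L i) (by linarith) (hL i).le
    have h6 : (k : ℝ) < ⌊y i / L i⌋ + 1 :=
      lt_of_mul_lt_mul_left (a := L i) (by linarith) (hL i).le
    have h7 : ⌊y i / L i⌋ < k := by exact_mod_cast h5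
    have h8 : k < ⌊y i / L i⌋ + 1 := by exact_mod_cast h6
    omega
  · -- inside the lattice cells the extension is a translate
    push Not at hx
    have hfl : ∀ i, ∀ᶠ y : Space d in 𝓝 x, ⌊y i / L i⌋ = ⌊x i / L i⌋ := by
      intro i
      have hcont : Continuous fun y : Space d => y i / L i := by fun_prop
      have h1 : (⌊x i / L i⌋ : ℝ) < x i / L i := by
        refine lt_of_le_of_ne (Int.floor_le _) fun h => hx i ⌊x i / L i⌋ ?_
        rw [h, mul_div_cancel₀ _ (hL i).ne']
      filter_upwards [hcont.continuousAt.eventually (Ioo_mem_nhds h1 (Int.lt_floor_add_one _))]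
        with y hy
      exact Int.floor_eq_iff.2 ⟨hy.1.le, hy.2⟩
    have htr : ContDiff ℝ ∞ fun y : Space d =>
        ζ (y - WithLp.toLp 2 fun i => L i * (⌊x i / L i⌋ : ℝ)) :=
      hζ.comp (contDiff_id.sub contDiff_const)
    refine htr.contDiffAt.congr_of_eventuallyEq ?_
    filter_upwards [eventually_all.2 hfl] with y hy
    congr 1
    ext i
    change L i * Int.fract (y i / L i) = y i - L i * (⌊x i / L i⌋ : ℝ)
    rw [Int.fract, mul_sub, mul_div_cancel₀ _ (hL i).ne', hy i]

/-- The integral of a partial derivative of a periodic function over the box vanishes. -/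
theorem setIntegral_fderiv_periodic {L : Fin d → ℝ} (hL : ∀ i, 0 < L i) {ζ : Space d → ℝ}
    (hζ : ContDiff ℝ ∞ ζ) (hper : ∀ x i, ζ (x + EuclideanSpace.single i (L i)) = ζ x)
    (i : Fin d) :
    ∫ x in {x : Space d | ∀ i, x i ∈ Set.Ioo 0 (L i)},
      fderiv ℝ ζ x (EuclideanSpace.single i 1) = 0 := by
  obtain ⟨n, rfl⟩ : ∃ n, d = n + 1 := ⟨d - 1, by have := i.2; omega⟩
  have hmp := PiLp.volume_preserving_toLp (Fin (n + 1))
  have hemb : MeasurableEmbedding (WithLp.toLp 2 : (Fin (n + 1) → ℝ) → Space (n + 1)) :=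
    (MeasurableEquiv.toLp 2 (Fin (n + 1) → ℝ)).measurableEmbedding
  rw [← hmp.setIntegral_preimage_emb hemb]
  have hset : (WithLp.toLp 2 : (Fin (n + 1) → ℝ) → Space (n + 1)) ⁻¹'
      {x | ∀ i, x i ∈ Set.Ioo 0 (L i)} = Set.univ.pi fun i => Set.Ioo 0 (L i) := by
    ext y; simp
  have hbox : (Set.univ.pi fun i => Set.Ioo 0 (L i)) =ᵐ[volume] Set.Icc (0 : Fin (n + 1) → ℝ) L :=
    Measure.univ_pi_Ioo_ae_eq_Icc
  rw [hset, setIntegral_congr_set hbox]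
  let T : (Fin (n + 1) → ℝ) →L[ℝ] Space (n + 1) :=
    (EuclideanSpace.equiv (Fin (n + 1)) ℝ).symm.toContinuousLinearMap
  have hT : ∀ y, T y = WithLp.toLp 2 y := fun y => rfl
  have hdiff : ∀ y, HasFDerivAt (fun y => ζ (T y)) ((fderiv ℝ ζ (T y)).comp T) y := fun y =>
    ((hζ.differentiable (by simp)) (T y)).hasFDerivAt.comp y T.hasFDerivAt
  have hcont : Continuous fun y => ζ (T y) := hζ.continuous.comp T.continuous
  have hcont' : Continuous fun y => (fderiv ℝ ζ (T y)) (EuclideanSpace.single i 1) :=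
    ((hζ.continuous_fderiv (by simp)).comp T.continuous).clm_apply continuous_const
  have hsum : ∀ y, ∑ j, (if j = i then (fderiv ℝ ζ (T y)).comp T else 0) (Pi.single j 1)
      = fderiv ℝ ζ (T y) (EuclideanSpace.single i 1) := by
    intro y
    rw [Finset.sum_eq_single i]
    · simp [hT]
    · intro j _ hj; simp [hj]
    · simp
  have key := integral_divergence_of_hasFDerivAt_off_countable' (E := ℝ) (0 : Fin (n + 1) → ℝ) L
    (fun i => (hL i).le) (fun j y => if j = i then ζ (T y) else 0)
    (fun j y => if j = i then (fderiv ℝ ζ (T y)).comp T else 0) ∅ Set.countable_empty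
    (fun j => by
      by_cases h : j = i
      · simpa [h] using hcont.continuousOn
      · simpa [h] using continuousOn_const)
    (fun y _ j => by
      by_cases h : j = i
      · simpa [h] using! hdiff y
      · simpa [h] using hasFDerivAt_const (0 : ℝ) y)
    (by
      simp_rw [hsum]
      exact hcont'.continuousOn.integrableOn_compact isCompact_Icc)
  simp_rw [hsum] at key
  refine Eq.trans ?_ (key.trans (Finset.sum_eq_zero fun j _ => ?_))
  · rfl
  · by_cases h : j = i
    · subst h
      rw [sub_eq_zero]
      congr 1
      funext y
      simp only [if_true]
      rw [← hper (T (j.insertNth ((0 : Fin (n + 1) → ℝ) j) y)) j]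
      congr 1
      ext k
      rw [PiLp.add_apply, hT, hT]
      refine Fin.succAboveCases j ?_ (fun k => ?_) k
      · simp
      · simp [Fin.succAbove_ne]
    · simp [h]

end Periodic

/-! ### Sobolev functions of the two settings -/

section Sobolev

variable {d : ℕ}

theorem Setting.isOpen_domain (G : Setting d) : IsOpen G.domain := by
  cases G with
  | periodic L hL => exact isOpen_box L
  | noFlux Ω hΩ => exact hΩ.isOpen

theorem Setting.nonempty_domain (G : Setting d) : G.domain.Nonempty := by
  cases G with
  | periodic L hL => exact box_nonempty hL
  | noFlux Ω hΩ => exact hΩ.isConnected.nonempty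

theorem Setting.linked_domain (G : Setting d) : Linked G.domain G.domain G.domain := by
  cases G with
  | periodic L hL =>
    exact Linked.of_visible (isOpen_box L) (Setting.periodic L hL).isBounded_domain
      (isOpen_box L).measurableSet (isOpen_box L).measurableSet subset_rfl subset_rfl
      fun x hx z hz => (convex_box L).segment_subset hz hx
  | noFlux Ω hΩ => exact hΩ.linked

theorem Setting.volume_domain_ne_zero (G : Setting d) : volume G.domain ≠ 0 :=
  (G.isOpen_domain.measure_pos volume G.nonempty_domain).ne'

theorem Setting.volume_domain_ne_top (G : Setting d) : volume G.domain ≠ ⊤ :=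
  G.isBounded_domain.measure_lt_top.ne

/-- The weak derivatives of an `H¹` function can be tested with any smooth function with compact
support in the domain, in the periodic case because its periodic extension is a test function. -/
theorem integral_toL2_mul_fderiv {G : Setting d} (u : H1 G) {ζ : Space d → ℝ} (hζ : ContDiff ℝ ∞ ζ)
    (hc : HasCompactSupport ζ) (hs : tsupport ζ ⊆ G.domain) (i : Fin d) :
    ∫ x, toL2 u x * fderiv ℝ ζ x (EuclideanSpace.single i 1) ∂G.vol
      = -∫ x, grad u x i * ζ x ∂G.vol := by
  cases G with
  | noFlux Ω hΩ => exact u.2 ζ ⟨hζ, hc, hs⟩ i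
  | periodic L hL =>
    have h := u.2 (fun x => ζ (wrap L x)) ⟨contDiff_comp_wrap hL hζ hc hs, fun x i => by
      exact congrArg ζ (wrap_add_single hL x i)⟩ i
    have hm : MeasurableSet {x : Space d | ∀ i, x i ∈ Set.Ioo 0 (L i)} :=
      (isOpen_box L).measurableSet
    have e1 : ∫ x, toL2 u x * fderiv ℝ ζ x (EuclideanSpace.single i 1)
          ∂(Setting.periodic L hL).vol
        = ∫ x, toL2 u x * fderiv ℝ (fun x => ζ (wrap L x)) x (EuclideanSpace.single i 1)
          ∂(Setting.periodic L hL).vol := by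
      refine setIntegral_congr_fun hm fun x hx => ?_
      have : (fun x => ζ (wrap L x)) =ᶠ[nhds x] ζ := by
        filter_upwards [(isOpen_box L).mem_nhds hx] with y hy
        rw [wrap_eq_self hL hy]
      simp only [this.fderiv_eq]
    have e2 : ∫ x, grad u x i * ζ x ∂(Setting.periodic L hL).vol
        = ∫ x, grad u x i * ζ (wrap L x) ∂(Setting.periodic L hL).vol := by
      refine setIntegral_congr_fun hm fun x hx => ?_
      simp only [wrap_eq_self hL hx]
    rw [e1, e2]
    exact h

theorem hasWeakGrad_indicator {G : Setting d} (u : H1 G) :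
    HasWeakGrad G.domain (G.domain.indicator (toL2 u)) (G.domain.indicator (grad u)) := by
  intro ζ hζ hc hs i
  have hm := G.isOpen_domain.measurableSet
  have h := integral_toL2_mul_fderiv u hζ hc hs i
  have e1 : ∀ x, G.domain.indicator (toL2 u) x * fderiv ℝ ζ x (EuclideanSpace.single i 1)
      = G.domain.indicator
        (fun x => toL2 u x * fderiv ℝ ζ x (EuclideanSpace.single i 1)) x := fun x => by
    by_cases hx : x ∈ G.domain <;> simp [hx]
  have e2 : ∀ x, G.domain.indicator (grad u) x i * ζ x
      = G.domain.indicator (fun x => grad u x i * ζ x) x := fun x => by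
    by_cases hx : x ∈ G.domain <;> simp [hx]
  simp_rw [e1, e2]
  exact (integral_indicator hm).trans (h.trans (congrArg Neg.neg (integral_indicator hm).symm))

/-- **Poincaré inequality** for the mean-zero functions of `H¹(Ω)`. -/
theorem exists_poincare (G : Setting d) :
    ∃ C : ℝ, 0 < C ∧ ∀ u : MeanZero G, ‖toL2 u.1‖ ^ 2 ≤ C * ‖grad u.1‖ ^ 2 := by
  obtain ⟨C, hC, h⟩ := G.linked_domain.poincare G.volume_domain_ne_zero G.volume_domain_ne_top
  have hm := G.isOpen_domain.measurableSet
  have hnorm : ∀ {F : Type} [NormedAddCommGroup F] (v : Lp F 2 G.vol),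
      ENNReal.ofReal (‖v‖ ^ 2) = ∫⁻ x in G.domain, ‖v x‖ₑ ^ 2 := by
    intro F _ v
    rw [ENNReal.ofReal_pow (norm_nonneg _), Lp.norm_def, ENNReal.ofReal_toReal (Lp.eLpNorm_ne_top v),
       eLpNorm_eq_lintegral_rpow_enorm_toReal
      (by norm_num) (by norm_num), ← ENNReal.rpow_natCast, ← ENNReal.rpow_mul]
    norm_num
    rfl
  refine ⟨C.toReal + 1, by positivity, fun u => ?_⟩
  have i1 : Integrable (toL2 u.1) G.vol := (Lp.memLp _).integrable (by norm_num)
  have i2 : Integrable (grad u.1) G.vol := (Lp.memLp _).integrable (by norm_num)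
  have e1 : ∀ x ∈ G.domain, G.domain.indicator (toL2 u.1) x = toL2 u.1 x := fun x hx => by
    simp [hx]
  have hu := h (G.domain.indicator (toL2 u.1)) (G.domain.indicator (grad u.1))
    ((Lp.stronglyMeasurable _).measurable.indicator hm)
    ((integrable_indicator_iff hm).2 i1).integrableOn
    ((integrable_indicator_iff hm).2 i1).locallyIntegrable
    ((integrable_indicator_iff hm).2 i2).locallyIntegrable (hasWeakGrad_indicator u.1)
    ((setIntegral_congr_fun hm e1).trans u.2)
  rw [setLIntegral_congr_fun hm (g := fun x => ‖toL2 u.1 x‖ₑ ^ 2) fun x hx => by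
    simp only [e1 x hx]] at hu
  have e2 : ∫⁻ y, ‖G.domain.indicator (grad u.1) y‖ₑ ^ 2
      = ∫⁻ y in G.domain, ‖grad u.1 y‖ₑ ^ 2 := by
    rw [← lintegral_indicator hm]
    refine lintegral_congr fun x => ?_
    by_cases hx : x ∈ G.domain <;> simp [hx]
  rw [e2, ← hnorm, ← hnorm, ← ENNReal.ofReal_toReal hC,
    ← ENNReal.ofReal_mul ENNReal.toReal_nonneg, ENNReal.ofReal_le_ofReal_iff (by positivity)] at hu
  nlinarith [sq_nonneg ‖grad u.1‖]

/-- The integral of a partial derivative of a test function vanishes, without boundary terms. -/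
theorem Setting.IsTest.integral_fderiv {G : Setting d} {ζ : Space d → ℝ} (h : G.IsTest ζ)
    (i : Fin d) : ∫ x, fderiv ℝ ζ x (EuclideanSpace.single i 1) ∂G.vol = 0 := by
  cases G with
  | periodic L hL => exact setIntegral_fderiv_periodic hL h.1 h.2 i
  | noFlux Ω hΩ =>
    obtain ⟨hζ, hc, hs⟩ := h
    have hcont : Continuous fun x => fderiv ℝ ζ x (EuclideanSpace.single i 1) :=
      (hζ.continuous_fderiv (by simp)).clm_apply continuous_const
    have hsub : Function.support (fun x => fderiv ℝ ζ x (EuclideanSpace.single i 1))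
        ⊆ tsupport ζ := fun x hx => by
      refine support_fderiv_subset ℝ fun h0 => hx ?_
      simp only [h0, zero_apply]
    have hi : Integrable fun x => fderiv ℝ ζ x (EuclideanSpace.single i 1) :=
      hcont.integrable_of_hasCompactSupport (HasCompactSupport.of_support_subset_isCompact hc hsub)
    have key := integral_bilinear_hasLineDerivAt_right_eq_neg_left_of_integrable
      (μ := (volume : Measure (Space d))) (f := fun _ => (1 : ℝ)) (f' := fun _ => (0 : ℝ))
      (g := ζ) (g' := fun x => fderiv ℝ ζ x (EuclideanSpace.single i 1))
      (v := EuclideanSpace.single i 1) (B := ContinuousLinearMap.mul ℝ ℝ)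
      (by simp) (by simpa using hi)
      (by simpa using hζ.continuous.integrable_of_hasCompactSupport hc)
      (fun x _ => by simpa [HasLineDerivAt] using hasDerivAt_const (0 : ℝ) (1 : ℝ))
      (fun x _ => ((hζ.differentiable (by simp)) x).hasFDerivAt.hasLineDerivAt _)
    simp only [ContinuousLinearMap.mul_apply', one_mul, zero_mul, integral_zero, neg_zero] at key
    change ∫ x in Ω, _ = 0
    rw [setIntegral_eq_integral_of_forall_compl_eq_zero, key]
    intro x hx
    by_contra h0
    exact hx (hs (hsub h0))

/-- The constant function `1` as an element of `H¹(Ω)`. -/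
noncomputable def H1.one (G : Setting d) : H1 G :=
  ⟨WithLp.toLp 2 ((memLp_const (1 : ℝ)).toLp _, 0), by
    intro ζ hζ i
    have h1 : ∀ᵐ x ∂G.vol, ((memLp_const (μ := G.vol) (p := 2) (1 : ℝ)).toLp _) x
        * fderiv ℝ ζ x (EuclideanSpace.single i 1)
        = fderiv ℝ ζ x (EuclideanSpace.single i 1) := by
      filter_upwards [(memLp_const (μ := G.vol) (p := 2) (1 : ℝ)).coeFn_toLp] with x hx
      rw [hx, one_mul]
    have h2 : ∀ᵐ x ∂G.vol, ((0 : L2Vec G) : Space d → Space d) x i * ζ x = 0 := by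
      filter_upwards [Lp.coeFn_zero (Space d) 2 G.vol] with x hx
      rw [hx, Pi.zero_apply, PiLp.zero_apply, zero_mul]
    have h3 : -∫ x, ((0 : L2Vec G) : Space d → Space d) x i * ζ x ∂G.vol = 0 := by
      rw [integral_congr_ae h2]; simp
    exact (integral_congr_ae h1).trans ((hζ.integral_fderiv i).trans h3.symm)⟩

theorem coeFn_toL2_one (G : Setting d) : toL2 (H1.one G) =ᵐ[G.vol] fun _ => 1 :=
  (memLp_const (μ := G.vol) (p := 2) (1 : ℝ)).coeFn_toLp

theorem grad_one (G : Setting d) : grad (H1.one G) = 0 := rfl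

end Sobolev

/-! ### The abstract variational problem -/

/-- Hilbert space data behind the scheme: `X` plays the role of `H¹(Ω)` with the embedding `τ` into
`E = L²(Ω)` and the gradient `D` into `F = L²(Ω)ᵈ`, `V` is the subspace of the elements with zero
mean, `one` the constant function, `M` the multiplication by the mobility, `K` the
multiplication by `H*`, `c = 3 / (2 δt)` and `e` is the squared interfacial width. The number `κ` is
a lower bound for the mobility, and `C` a constant for the Poincaré inequality. -/
structure VariationalData (X E F : Type*) [NormedAddCommGroup X] [InnerProductSpace ℝ X]
    [NormedAddCommGroup E] [InnerProductSpace ℝ E] [NormedAddCommGroup F]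
    [InnerProductSpace ℝ F] where
  τ : X →L[ℝ] E
  D : X →L[ℝ] F
  M : F →L[ℝ] F
  K : E →L[ℝ] E
  V : Submodule ℝ X
  one : X
  c : ℝ
  e : ℝ
  κ : ℝ
  C : ℝ
  c_pos : 0 < c
  e_pos : 0 < e
  κ_pos : 0 < κ
  C_pos : 0 < C
  norm_sq : ∀ u, ‖u‖ ^ 2 = ‖τ u‖ ^ 2 + ‖D u‖ ^ 2
  D_one : D one = 0
  τ_one : τ one ≠ 0
  mem_V : ∀ u, u ∈ V ↔ inner ℝ (τ u) (τ one) = 0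
  poincare : ∀ u ∈ V, ‖τ u‖ ^ 2 ≤ C * ‖D u‖ ^ 2
  M_symm : ∀ f g, inner ℝ (M f) g = inner ℝ f (M g)
  M_coercive : ∀ f, κ * ‖f‖ ^ 2 ≤ inner ℝ (M f) f

/-- The continuous bilinear form `(v, w) ↦ ⟪S v, T w⟫`. -/
noncomputable def innerForm {X Y E : Type*} [NormedAddCommGroup X] [NormedSpace ℝ X]
    [NormedAddCommGroup Y] [NormedSpace ℝ Y]
    [NormedAddCommGroup E] [InnerProductSpace ℝ E] (S : X →L[ℝ] E) (T : Y →L[ℝ] E) :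
    X →L[ℝ] Y →L[ℝ] ℝ :=
  (isBoundedBilinearMap_inner (𝕜 := ℝ) (E := E)).toContinuousLinearMap.bilinearComp S T

@[simp]
theorem innerForm_apply {X Y E : Type*} [NormedAddCommGroup X] [NormedSpace ℝ X]
    [NormedAddCommGroup Y] [NormedSpace ℝ Y]
    [NormedAddCommGroup E] [InnerProductSpace ℝ E] (S : X →L[ℝ] E) (T : Y →L[ℝ] E) (v : X) (w : Y) :
    innerForm S T v w = inner ℝ (S v) (T w) := rfl

/-- The Lax-Milgram theorem for functionals. -/
theorem existsUnique_of_isCoercive {V : Type*} [NormedAddCommGroup V] [InnerProductSpace ℝ V]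
    [CompleteSpace V] {B : V →L[ℝ] V →L[ℝ] ℝ} (hB : IsCoercive B) (ℓ : V →L[ℝ] ℝ) :
    ∃! v, ∀ w, B v w = ℓ w := by
  refine ⟨hB.continuousLinearEquivOfBilin.symm ((InnerProductSpace.toDual ℝ V).symm ℓ), ?_, ?_⟩
  · intro w
    rw [← hB.continuousLinearEquivOfBilin_apply, ContinuousLinearEquiv.apply_symm_apply,
      InnerProductSpace.toDual_symm_apply]
  · intro v hv
    rw [ContinuousLinearEquiv.eq_symm_apply]
    refine ext_inner_right ℝ fun w => ?_
    rw [hB.continuousLinearEquivOfBilin_apply, InnerProductSpace.toDual_symm_apply, hv w]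

namespace VariationalData

variable {X E F : Type*} [NormedAddCommGroup X] [InnerProductSpace ℝ X]
  [NormedAddCommGroup E] [InnerProductSpace ℝ E] [NormedAddCommGroup F]
  [InnerProductSpace ℝ F] (P : VariationalData X E F)

/-- The form `(M ∇v, ∇w)` on the mean-zero subspace. -/
noncomputable def mobilityForm : P.V →L[ℝ] P.V →L[ℝ] ℝ :=
  innerForm (P.M ∘L P.D ∘L P.V.subtypeL) (P.D ∘L P.V.subtypeL)

theorem mobilityForm_apply (v w : P.V) :
    P.mobilityForm v w = inner ℝ (P.M (P.D v)) (P.D w) := rfl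

theorem norm_sq_le (u : P.V) : ‖u‖ ^ 2 ≤ (P.C + 1) * ‖P.D u‖ ^ 2 := by
  have h1 := P.norm_sq u
  have h2 := P.poincare u u.2
  rw [Submodule.coe_norm] at *
  linarith

theorem isCoercive_of_le {B : P.V →L[ℝ] P.V →L[ℝ] ℝ} {a : ℝ} (ha : 0 < a)
    (h : ∀ v : P.V, a * ‖P.D v‖ ^ 2 ≤ B v v) : IsCoercive B := by
  have hC := P.C_pos
  refine ⟨a / (P.C + 1), by positivity, fun u => ?_⟩
  refine le_trans ?_ (h u)
  rw [mul_assoc, ← sq, div_mul_eq_mul_div, div_le_iff₀ (by positivity)]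
  nlinarith [P.norm_sq_le u]

theorem isCoercive_mobilityForm : IsCoercive P.mobilityForm :=
  P.isCoercive_of_le P.κ_pos fun v => P.M_coercive (P.D v)

/-- Every element is the sum of a mean-zero element and a constant. -/
theorem exists_decomp (w : X) : ∃ (w₀ : P.V) (a : ℝ), w = w₀ + a • P.one := by
  have h : inner ℝ (P.τ P.one) (P.τ P.one) ≠ (0 : ℝ) := inner_self_ne_zero.2 P.τ_one
  set a := inner ℝ (P.τ w) (P.τ P.one) / inner ℝ (P.τ P.one) (P.τ P.one) with ha
  refine ⟨⟨w - a • P.one, ?_⟩, a, by simp⟩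
  rw [P.mem_V, map_sub, map_smul, inner_sub_left, real_inner_smul_left, ha, div_mul_cancel₀ _ h,
    sub_self]

/-- Testing with mean-zero elements suffices. -/
theorem mass_iff (ψ : P.V) (μ : X) :
    (∀ w : X, inner ℝ (P.τ ψ) (P.τ w) = -inner ℝ (P.M (P.D μ)) (P.D w)) ↔
      ∀ w : P.V, inner ℝ (P.τ ψ) (P.τ w) = -inner ℝ (P.M (P.D μ)) (P.D w) := by
  refine ⟨fun h w => h w, fun h w => ?_⟩
  obtain ⟨w₀, a, rfl⟩ := P.exists_decomp w
  have h1 := (P.mem_V ψ).1 ψ.2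
  simp only [map_add, map_smul, inner_add_right, real_inner_smul_right, P.D_one, inner_zero_right,
    h1, h w₀]
  ring

/-- The pairing of `P₂ ψ = -ε² Δψ + ½ H* H* ψ` with `χ`. -/
noncomputable def form (ψ χ : X) : ℝ :=
  P.e * inner ℝ (P.D ψ) (P.D χ) + 1 / 2 * inner ℝ (P.K (P.τ ψ)) (P.K (P.τ χ))

/-- The reduced scheme in terms of `ψ = φ - history`, with the linear functional `ℓ` of the data. -/
structure IsSolution (ℓ : X →L[ℝ] ℝ) (ψ μ : X) : Prop where
  mass : ∀ v : X, P.c * inner ℝ (P.τ ψ) (P.τ v) = -inner ℝ (P.M (P.D μ)) (P.D v)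
  potential : ∀ w : X, inner ℝ (P.τ μ) (P.τ w) = P.form ψ w - ℓ w

variable {P} in
theorem IsSolution.mem_V {ℓ : X →L[ℝ] ℝ} {ψ μ : X} (h : P.IsSolution ℓ ψ μ) : ψ ∈ P.V := by
  have := h.mass P.one
  rw [P.D_one, inner_zero_right, neg_zero, mul_eq_zero] at this
  exact (P.mem_V ψ).2 (this.resolve_left P.c_pos.ne')

variable [CompleteSpace P.V] [CompleteSpace E]

/-- The inverse quasi-Laplacian `Δ⁻¹` on the mean-zero subspace. -/
noncomputable def invLaplace : P.V →L[ℝ] P.V :=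
  -(P.isCoercive_mobilityForm.continuousLinearEquivOfBilin.symm : P.V →L[ℝ] P.V) ∘L
    ContinuousLinearMap.adjoint (P.τ ∘L P.V.subtypeL) ∘L (P.τ ∘L P.V.subtypeL)

theorem invLaplace_spec (ψ : P.V) (w : X) :
    -inner ℝ (P.M (P.D (P.invLaplace ψ))) (P.D w) = inner ℝ (P.τ ψ) (P.τ w) := by
  refine ((P.mass_iff ψ (P.invLaplace ψ)).2 (fun w => ?_) w).symm
  rw [← mobilityForm_apply, ← P.isCoercive_mobilityForm.continuousLinearEquivOfBilin_apply]
  simp [invLaplace, ContinuousLinearMap.adjoint_inner_left]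

theorem invLaplace_unique {ψ v : P.V}
    (h : ∀ w : P.V, -inner ℝ (P.M (P.D v)) (P.D w) = inner ℝ (P.τ ψ) (P.τ w)) :
    v = P.invLaplace ψ := by
  refine (existsUnique_of_isCoercive P.isCoercive_mobilityForm
    (-innerForm (P.τ ∘L P.V.subtypeL) (P.τ ∘L P.V.subtypeL) ψ)).unique ?_ ?_
  · intro w
    have := h w
    simp only [mobilityForm_apply, neg_apply, innerForm_apply,
      ContinuousLinearMap.comp_apply, Submodule.subtypeL_apply]
    linarith
  · intro w
    have := P.invLaplace_spec ψ w
    simp only [mobilityForm_apply, neg_apply, innerForm_apply,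
      ContinuousLinearMap.comp_apply, Submodule.subtypeL_apply]
    linarith

/-- The operator `-(3 / (2 δt)) Δ⁻¹ + P₂` as a bilinear form on the mean-zero subspace. -/
noncomputable def operator : P.V →L[ℝ] P.V →L[ℝ] ℝ :=
  -P.c • innerForm (P.τ ∘L P.V.subtypeL ∘L P.invLaplace) (P.τ ∘L P.V.subtypeL)
    + (P.e • innerForm (P.D ∘L P.V.subtypeL) (P.D ∘L P.V.subtypeL)
      + (1 / 2 : ℝ) • innerForm (P.K ∘L P.τ ∘L P.V.subtypeL) (P.K ∘L P.τ ∘L P.V.subtypeL))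

theorem operator_apply (ψ χ : P.V) :
    P.operator ψ χ = -P.c * inner ℝ (P.τ (P.invLaplace ψ)) (P.τ χ) + P.form ψ χ := by
  simp [operator, form]

/-- `(Δ⁻¹ψ, χ) = -(M ∇Δ⁻¹χ, ∇Δ⁻¹ψ)`, which shows symmetry and sign of the nonlocal part. -/
theorem inner_invLaplace (ψ χ : P.V) : inner ℝ (P.τ (P.invLaplace ψ)) (P.τ χ)
    = -inner ℝ (P.M (P.D (P.invLaplace χ))) (P.D (P.invLaplace ψ)) := by
  rw [P.invLaplace_spec, real_inner_comm]

theorem operator_symm (ψ χ : P.V) : P.operator ψ χ = P.operator χ ψ := by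
  rw [operator_apply, operator_apply, inner_invLaplace, inner_invLaplace, P.M_symm,
    real_inner_comm _ (P.D _)]
  unfold form
  rw [real_inner_comm (P.D ψ), real_inner_comm (P.K (P.τ ψ))]

theorem le_operator (ψ : P.V) : P.e * ‖P.D ψ‖ ^ 2 ≤ P.operator ψ ψ := by
  have h1 := (mul_nonneg P.κ_pos.le (sq_nonneg _)).trans
    (P.M_coercive (P.D (P.invLaplace ψ)))
  rw [operator_apply, inner_invLaplace, form, real_inner_self_eq_norm_sq,
    real_inner_self_eq_norm_sq]
  nlinarith [sq_nonneg ‖P.K (P.τ ψ)‖, mul_nonneg P.c_pos.le h1]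

theorem isCoercive_operator : IsCoercive P.operator :=
  P.isCoercive_of_le P.e_pos P.le_operator

variable {P}

theorem IsSolution.operator_eq {ℓ : X →L[ℝ] ℝ} {ψ : P.V} {μ : X} (h : P.IsSolution ℓ ψ μ)
    (χ : P.V) : P.operator ψ χ = ℓ χ := by
  obtain ⟨μ₀, a, rfl⟩ := P.exists_decomp μ
  have hμ : P.c⁻¹ • μ₀ = P.invLaplace ψ := by
    refine P.invLaplace_unique fun w => ?_
    have := h.mass w
    simp only [map_add, map_smul, P.D_one, smul_zero, add_zero] at this
    simp only [Submodule.coe_smul, map_smul, real_inner_smul_left]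
    rw [← mul_neg, ← this, inv_mul_cancel_left₀ P.c_pos.ne']
  have h1 := h.potential χ
  have h2 := (P.mem_V χ).1 χ.2
  simp only [map_add, map_smul, inner_add_left, real_inner_smul_left,
    real_inner_comm (P.τ χ) (P.τ P.one), h2] at h1
  rw [operator_apply, ← hμ]
  simp only [Submodule.coe_smul, map_smul, real_inner_smul_left]
  field_simp [P.c_pos.ne']
  linarith

theorem exists_isSolution {ℓ : X →L[ℝ] ℝ} {ψ : P.V} (h : ∀ χ : P.V, P.operator ψ χ = ℓ χ) :
    ∃ μ, P.IsSolution ℓ ψ μ := by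
  have h0 : inner ℝ (P.τ P.one) (P.τ P.one) ≠ (0 : ℝ) := inner_self_ne_zero.2 P.τ_one
  -- the additive constant is fixed by testing the second equation with the constant function
  set a := (P.form ψ P.one - ℓ P.one) / inner ℝ (P.τ P.one) (P.τ P.one) with ha
  have ha' : a * inner ℝ (P.τ P.one) (P.τ P.one) = P.form ψ P.one - ℓ P.one := by
    rw [ha, div_mul_cancel₀ _ h0]
  refine ⟨P.c • (P.invLaplace ψ : X) + a • P.one, fun v => ?_, fun w => ?_⟩
  · simp only [map_add, map_smul, P.D_one, smul_zero, add_zero, real_inner_smul_left,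
      ← P.invLaplace_spec ψ v]
    ring
  · obtain ⟨w₀, b, rfl⟩ := P.exists_decomp w
    have h1 := h w₀
    rw [operator_apply] at h1
    have h2 := (P.mem_V w₀).1 w₀.2
    have h3 := (P.mem_V (P.invLaplace ψ)).1 (P.invLaplace ψ).2
    have h4 : P.form ψ (w₀ + b • P.one) = P.form ψ w₀ + b * P.form ψ P.one := by
      simp only [form, map_add, map_smul, inner_add_right, real_inner_smul_right]
      ring
    have h5 : ℓ (w₀ + b • P.one) = ℓ w₀ + b * ℓ P.one := by simp
    rw [h4, h5]
    simp only [map_add, map_smul, inner_add_left, real_inner_smul_left, inner_add_right,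
      real_inner_smul_right, real_inner_comm (P.τ w₀) (P.τ P.one), h2, h3]
    linear_combination -h1 + b * ha'

theorem IsSolution.unique {ℓ : X →L[ℝ] ℝ} {ψ μ ψ' μ' : X} (h : P.IsSolution ℓ ψ μ)
    (h' : P.IsSolution ℓ ψ' μ') : ψ = ψ' ∧ μ = μ' := by
  lift ψ to P.V using h.mem_V
  lift ψ' to P.V using h'.mem_V
  have e := (existsUnique_of_isCoercive P.isCoercive_operator (ℓ ∘L P.V.subtypeL)).unique
    h.operator_eq h'.operator_eq
  subst e
  refine ⟨rfl, ?_⟩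
  rw [← sub_eq_zero, ← norm_eq_zero, ← sq_eq_zero_iff, P.norm_sq]
  have h1 : ‖P.τ (μ - μ')‖ ^ 2 = 0 := by
    rw [← real_inner_self_eq_norm_sq]
    nth_rw 1 [map_sub]
    rw [inner_sub_left, h.potential, h'.potential, sub_self]
  have h2 : ‖P.D (μ - μ')‖ ^ 2 ≤ 0 := by
    have := P.M_coercive (P.D (μ - μ'))
    have e : inner ℝ (P.M (P.D (μ - μ'))) (P.D (μ - μ'))
        = inner ℝ (P.M (P.D μ)) (P.D (μ - μ')) - inner ℝ (P.M (P.D μ')) (P.D (μ - μ')) := by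
      rw [← inner_sub_left, ← map_sub, ← map_sub]
    have h3 := h.mass (μ - μ')
    have h4 := h'.mass (μ - μ')
    nlinarith [P.κ_pos]
  nlinarith [sq_nonneg ‖P.D (μ - μ')‖]

variable (P) in
theorem exists_solution (ℓ : X →L[ℝ] ℝ) : ∃ ψ μ, P.IsSolution ℓ ψ μ := by
  obtain ⟨ψ, hψ, -⟩ := existsUnique_of_isCoercive P.isCoercive_operator (ℓ ∘L P.V.subtypeL)
  obtain ⟨μ, hμ⟩ := exists_isSolution hψ
  exact ⟨ψ, μ, hμ⟩

end VariationalData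

/-- The telescoping identity behind the `G`-stability of BDF2, with the nonnegative remainder
`‖a - 2 b + c‖²` dropped. -/
theorem bdf2_inner_ge {E : Type*} [NormedAddCommGroup E] [InnerProductSpace ℝ E] (a b c : E) :
    (‖a‖ ^ 2 + ‖(2 : ℝ) • a - b‖ ^ 2 - ‖b‖ ^ 2 - ‖(2 : ℝ) • b - c‖ ^ 2) / 2
      ≤ inner ℝ a ((3 : ℝ) • a - (4 : ℝ) • b + c) := by
  have h := sq_nonneg ‖a - (2 : ℝ) • b + c‖
  simp only [← real_inner_self_eq_norm_sq, inner_sub_left, inner_sub_right, inner_add_left,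
    inner_add_right, real_inner_smul_left, real_inner_smul_right] at h ⊢
  rw [real_inner_comm b a, real_inner_comm c a, real_inner_comm c b] at *
  linarith

/-! ### The Hilbert spaces of the scheme -/

variable {d : ℕ}

/-- `toL2` as a continuous linear map. -/
noncomputable def toL2L (G : Setting d) : H1 G →L[ℝ] L2 G :=
  WithLp.fstL 2 ℝ (L2 G) (L2Vec G) ∘L (H1 G).subtypeL

/-- `grad` as a continuous linear map. -/
noncomputable def gradL (G : Setting d) : H1 G →L[ℝ] L2Vec G :=
  WithLp.sndL 2 ℝ (L2 G) (L2Vec G) ∘L (H1 G).subtypeL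

theorem inner_L2_eq {G : Setting d} (f g : L2 G) :
    inner ℝ f g = ∫ x, f x * g x ∂G.vol := by
  rw [L2.inner_def]
  refine integral_congr_ae (Filter.Eventually.of_forall fun x => ?_)
  simp [mul_comm]

theorem norm_sq_H1 {G : Setting d} (u : H1 G) : ‖u‖ ^ 2 = ‖toL2 u‖ ^ 2 + ‖grad u‖ ^ 2 :=
  WithLp.prod_norm_sq_eq_of_L2 (u : WithLp 2 (L2 G × L2Vec G))

/-- `H¹(Ω)` is closed in `L² × L²`, because each test function gives a continuous functional. -/
theorem isClosed_H1 (G : Setting d) : IsClosed (H1 G : Set (WithLp 2 (L2 G × L2Vec G))) := by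
  have e : (H1 G : Set (WithLp 2 (L2 G × L2Vec G))) = ⋂ (ζ : Space d → ℝ) (_ : G.IsTest ζ)
      (i : Fin d), {q | ∫ x, q.fst x * fderiv ℝ ζ x (EuclideanSpace.single i 1) ∂G.vol
        = -∫ x, q.snd x i * ζ x ∂G.vol} := by
    ext q
    simp only [Set.mem_iInter]
    rfl
  rw [e]
  refine isClosed_iInter fun ζ => isClosed_iInter fun hζ => isClosed_iInter fun i => ?_
  have c1 : Continuous fun x => fderiv ℝ ζ x (EuclideanSpace.single i 1) :=
    (hζ.contDiff.continuous_fderiv (by simp)).clm_apply continuous_const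
  have m1 := G.memLp_of_continuous c1
  have m2 : MemLp (fun x => ζ x • (EuclideanSpace.single i 1 : Space d)) 2 G.vol := by
    have := (ContinuousLinearMap.toSpanSingleton ℝ
      (EuclideanSpace.single i 1 : Space d)).comp_memLp'
      (G.memLp_of_continuous hζ.contDiff.continuous)
    exact this
  have e1 : ∀ q : WithLp 2 (L2 G × L2Vec G),
      ∫ x, q.fst x * fderiv ℝ ζ x (EuclideanSpace.single i 1) ∂G.vol
        = inner ℝ q.fst (m1.toLp _) := by
    intro q
    rw [inner_L2_eq]
    refine integral_congr_ae ?_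
    filter_upwards [m1.coeFn_toLp] with x hx
    rw [hx]
  have e2 : ∀ q : WithLp 2 (L2 G × L2Vec G),
      ∫ x, q.snd x i * ζ x ∂G.vol = inner ℝ q.snd (m2.toLp _) := by
    intro q
    rw [L2.inner_def]
    refine integral_congr_ae ?_
    filter_upwards [m2.coeFn_toLp] with x hx
    rw [hx, real_inner_smul_right, EuclideanSpace.inner_single_right]
    simp [mul_comm]
  simp only [e1, e2]
  have hf : Continuous fun q : WithLp 2 (L2 G × L2Vec G) => q.fst :=
    (WithLp.fstL 2 ℝ (L2 G) (L2Vec G)).continuous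
  have hs : Continuous fun q : WithLp 2 (L2 G × L2Vec G) => q.snd :=
    (WithLp.sndL 2 ℝ (L2 G) (L2Vec G)).continuous
  exact isClosed_eq (hf.inner continuous_const) (hs.inner continuous_const).neg

instance (G : Setting d) : CompleteSpace (H1 G) := (isClosed_H1 G).completeSpace_coe

theorem mem_MeanZero_iff {G : Setting d} (u : H1 G) :
    u ∈ MeanZero G ↔ inner ℝ (toL2 u) (toL2 (H1.one G)) = 0 := by
  have e : ∫ x, toL2 u x ∂G.vol = inner ℝ (toL2 u) (toL2 (H1.one G)) := by
    rw [inner_L2_eq]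
    refine integral_congr_ae ?_
    filter_upwards [coeFn_toL2_one G] with x hx
    rw [hx, mul_one]
  rw [← e]
  rfl

theorem isClosed_MeanZero (G : Setting d) : IsClosed (MeanZero G : Set (H1 G)) := by
  have e : (MeanZero G : Set (H1 G)) = {u | inner ℝ (toL2L G u) (toL2 (H1.one G)) = 0} :=
    Set.ext fun u => mem_MeanZero_iff u
  rw [e]
  exact isClosed_eq ((toL2L G).continuous.inner continuous_const) continuous_const

instance (G : Setting d) : CompleteSpace (MeanZero G) := (isClosed_MeanZero G).completeSpace_coe

theorem toL2_one_ne_zero (G : Setting d) : toL2 (H1.one G) ≠ 0 := by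
  intro h
  have h1 := coeFn_toL2_one G
  rw [h] at h1
  have h2 : ∀ᵐ x ∂G.vol, False := by
    filter_upwards [h1, Lp.coeFn_zero ℝ 2 G.vol] with x hx hx'
    rw [hx'] at hx
    exact zero_ne_one hx
  rw [Filter.eventually_false_iff_eq_bot, ae_eq_bot, Setting.vol, Measure.restrict_eq_zero] at h2
  exact G.volume_domain_ne_zero h2

/-! ### Multiplication operators -/

section MulOp

variable {α F : Type*} [MeasurableSpace α] {ν : Measure α} [NormedAddCommGroup F]
  [NormedSpace ℝ F]

theorem memLp_bounded_smul {m : α → ℝ} (hm : Measurable m) {C : ℝ} (hC : ∀ x, |m x| ≤ C)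
    (f : Lp F 2 ν) : MemLp (fun x => m x • f x) 2 ν :=
  (Lp.memLp f).of_le_mul (c := C) (hm.aestronglyMeasurable.smul (Lp.aestronglyMeasurable f))
    (Filter.Eventually.of_forall fun x => by
      rw [norm_smul]
      exact mul_le_mul_of_nonneg_right (hC x) (norm_nonneg _))

/-- Multiplication by a bounded measurable function, as an operator on `L²`. -/
noncomputable def mulOp (ν : Measure α) (F : Type*) [NormedAddCommGroup F] [NormedSpace ℝ F]
    {m : α → ℝ} (hm : Measurable m) {C : ℝ} (hC : ∀ x, |m x| ≤ C) :
    Lp F 2 ν →L[ℝ] Lp F 2 ν :=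
  LinearMap.mkContinuous
    { toFun := fun f => (memLp_bounded_smul hm hC f).toLp _
      map_add' := fun f g => by
        refine Lp.ext ?_
        filter_upwards [(memLp_bounded_smul hm hC f).coeFn_toLp,
          (memLp_bounded_smul hm hC g).coeFn_toLp, (memLp_bounded_smul hm hC (f + g)).coeFn_toLp,
          Lp.coeFn_add f g, Lp.coeFn_add ((memLp_bounded_smul hm hC f).toLp _)
          ((memLp_bounded_smul hm hC g).toLp _)] with x h1 h2 h3 h4 h5
        rw [h3, h5, Pi.add_apply, h1, h2, h4, Pi.add_apply, smul_add]
      map_smul' := fun c f => by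
        refine Lp.ext ?_
        filter_upwards [(memLp_bounded_smul hm hC f).coeFn_toLp,
          (memLp_bounded_smul hm hC (c • f)).coeFn_toLp, Lp.coeFn_smul c f,
          Lp.coeFn_smul c ((memLp_bounded_smul hm hC f).toLp _)] with x h1 h2 h3 h4
        rw [RingHom.id_apply, h2, h4, Pi.smul_apply, h1, h3, Pi.smul_apply, smul_comm] }
    C fun f => Lp.norm_le_mul_norm_of_ae_le_mul (by
      filter_upwards [(memLp_bounded_smul hm hC f).coeFn_toLp] with x hx
      change ‖(memLp_bounded_smul hm hC f).toLp _ x‖ ≤ _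
      rw [hx, norm_smul]
      exact mul_le_mul_of_nonneg_right (hC x) (norm_nonneg _))

theorem coeFn_mulOp {m : α → ℝ} (hm : Measurable m) {C : ℝ} (hC : ∀ x, |m x| ≤ C)
    (f : Lp F 2 ν) : mulOp ν F hm hC f =ᵐ[ν] fun x => m x • f x :=
  (memLp_bounded_smul hm hC f).coeFn_toLp

variable {F : Type*} [NormedAddCommGroup F] [InnerProductSpace ℝ F]

theorem inner_mulOp {m : α → ℝ} (hm : Measurable m) {C : ℝ} (hC : ∀ x, |m x| ≤ C)
    (f g : Lp F 2 ν) : inner ℝ (mulOp ν F hm hC f) g = ∫ x, m x * inner ℝ (f x) (g x) ∂ν := by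
  rw [L2.inner_def]
  refine integral_congr_ae ?_
  filter_upwards [coeFn_mulOp hm hC f] with x hx
  rw [hx, real_inner_smul_left]

theorem mulOp_symm {m : α → ℝ} (hm : Measurable m) {C : ℝ} (hC : ∀ x, |m x| ≤ C)
    (f g : Lp F 2 ν) : inner ℝ (mulOp ν F hm hC f) g = inner ℝ f (mulOp ν F hm hC g) := by
  rw [real_inner_comm _ f, inner_mulOp, inner_mulOp]
  simp_rw [real_inner_comm]

theorem le_inner_mulOp {m : α → ℝ} (hm : Measurable m) {C : ℝ} (hC : ∀ x, |m x| ≤ C) {κ : ℝ}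
    (hκ : ∀ x, κ ≤ m x) (f : Lp F 2 ν) : κ * ‖f‖ ^ 2 ≤ inner ℝ (mulOp ν F hm hC f) f := by
  rw [← real_inner_self_eq_norm_sq, ← real_inner_smul_left, L2.inner_def, L2.inner_def]
  refine integral_mono_ae (L2.integrable_inner _ _) (L2.integrable_inner _ _) ?_
  filter_upwards [coeFn_mulOp hm hC f, Lp.coeFn_smul κ f] with x h1 h2
  rw [h1, h2, Pi.smul_apply, real_inner_smul_left, real_inner_smul_left]
  exact mul_le_mul_of_nonneg_right (hκ x) real_inner_self_nonneg

end MulOp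

/-! ### The scheme as a variational problem -/

section Scheme

variable {G : Setting d} {p : Params}

theorem measurable_extrap (φo φn : H1 G) : Measurable (extrap φo φn) :=
  ((Lp.stronglyMeasurable _).measurable.const_mul 2).sub (Lp.stronglyMeasurable _).measurable

theorem measurable_mobility_extrap (φo φn : H1 G) :
    Measurable fun x => p.mobility (extrap φo φn x) :=
  Params.measurable_mobility.comp (measurable_extrap φo φn)

theorem measurable_H_extrap (hp : p.Admissible) (φo φn : H1 G) :
    Measurable fun x => p.H (extrap φo φn x) :=
  (Params.measurable_H hp).comp (measurable_extrap φo φn)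

/-- Multiplication of vector fields by the mobility `M(φ*)`. -/
noncomputable def mobilityOp (hp : p.Admissible) (φo φn : H1 G) : L2Vec G →L[ℝ] L2Vec G :=
  mulOp G.vol (Space d) (measurable_mobility_extrap φo φn) (C := 1 / 4) fun x => by
    rw [abs_of_pos (Params.mobility_pos hp _)]
    exact Params.mobility_le hp _

/-- Multiplication of functions by `H* = H(φ*)`. -/
noncomputable def couplingOp (hp : p.Admissible) (φo φn : H1 G) : L2 G →L[ℝ] L2 G :=
  mulOp G.vol ℝ (measurable_H_extrap hp φo φn) fun _ => Params.abs_H_le hp _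

/-- The Hilbert space data of the scheme. -/
noncomputable def schemeData (hp : p.Admissible) (φo φn : H1 G) :
    VariationalData (H1 G) (L2 G) (L2Vec G) where
  τ := toL2L G
  D := gradL G
  M := mobilityOp hp φo φn
  K := couplingOp hp φo φn
  V := MeanZero G
  one := H1.one G
  c := 3 / (2 * p.δt)
  e := p.ε ^ 2
  κ := p.σ / 8
  C := (exists_poincare G).choose
  c_pos := by have := hp.δt_pos; positivity
  e_pos := by have := hp.ε_pos; positivity
  κ_pos := by have := hp.σ_pos; positivity
  C_pos := (exists_poincare G).choose_spec.1
  norm_sq := norm_sq_H1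
  D_one := grad_one G
  τ_one := toL2_one_ne_zero G
  mem_V := mem_MeanZero_iff
  poincare := fun u hu => (exists_poincare G).choose_spec.2 ⟨u, hu⟩
  M_symm := mulOp_symm _ _
  M_coercive := le_inner_mulOp _ _ fun _ => Params.le_mobility hp _

instance (hp : p.Admissible) (φo φn : H1 G) : CompleteSpace (schemeData hp φo φn).V :=
  inferInstanceAs (CompleteSpace (MeanZero G))

/-- The average `(4 Uⁿ - Uⁿ⁻¹) / 3` of the data. -/
noncomputable def auxHistory (Uo Un : L2 G) : L2 G := (1 / 3 : ℝ) • ((4 : ℝ) • Un - Uo)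

theorem coeFn_auxHistory (Uo Un : L2 G) :
    auxHistory Uo Un =ᵐ[G.vol] fun x => (4 * Un x - Uo x) / 3 := by
  filter_upwards [Lp.coeFn_smul (1 / 3 : ℝ) ((4 : ℝ) • Un - Uo), Lp.coeFn_sub ((4 : ℝ) • Un) Uo,
    Lp.coeFn_smul (4 : ℝ) Un] with x h1 h2 h3
  rw [auxHistory, h1, Pi.smul_apply, h2, Pi.sub_apply, h3, Pi.smul_apply]
  simp only [smul_eq_mul]
  ring

theorem coeFn_history (φo φn : H1 G) :
    toL2 (history φo φn) =ᵐ[G.vol] fun x => (4 * toL2 φn x - toL2 φo x) / 3 :=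
  coeFn_auxHistory (toL2 φo) (toL2 φn)

/-- The linear functional of the data, on all of `H¹(Ω)`. -/
noncomputable def rhsFunctional (hp : p.Admissible) (φo φn : H1 G) (Uo Un : L2 G) :
    H1 G →L[ℝ] ℝ :=
  -(p.ε ^ 2 • (innerSL ℝ (grad (history φo φn)) ∘L gradL G))
    - innerSL ℝ (couplingOp hp φo φn (auxHistory Uo Un)) ∘L toL2L G

theorem rhsFunctional_apply (hp : p.Admissible) (φo φn : H1 G) (Uo Un : L2 G) (w : H1 G) :
    rhsFunctional hp φo φn Uo Un w = -(p.ε ^ 2 * inner ℝ (grad (history φo φn)) (grad w))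
      - inner ℝ (couplingOp hp φo φn (auxHistory Uo Un)) (toL2 w) := rfl

theorem schemeRhs_eq (hp : p.Admissible) (φo φn : H1 G) (Uo Un : L2 G) (χ : MeanZero G) :
    schemeRhs p φo φn Uo Un χ = rhsFunctional hp φo φn Uo Un χ := by
  rw [rhsFunctional_apply, schemeRhs, couplingOp, inner_mulOp, L2.inner_def]
  congr 1
  refine integral_congr_ae ?_
  filter_upwards [coeFn_auxHistory Uo Un] with x hx
  rw [hx]
  simp
  ring

theorem formP_eq (hp : p.Admissible) (φo φn ψ χ : H1 G) :
    formP p φo φn ψ χ = (schemeData hp φo φn).form ψ χ := by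
  change _ = p.ε ^ 2 * inner ℝ (grad ψ) (grad χ)
    + 1 / 2 * inner ℝ (couplingOp hp φo φn (toL2 ψ)) (couplingOp hp φo φn (toL2 χ))
  rw [formP, L2.inner_def, inner_L2_eq]
  congr 2
  refine integral_congr_ae ?_
  filter_upwards [coeFn_mulOp (measurable_H_extrap hp φo φn) (fun _ => Params.abs_H_le hp _)
    (toL2 ψ), coeFn_mulOp (measurable_H_extrap hp φo φn) (fun _ => Params.abs_H_le hp _)
    (toL2 χ)] with x h1 h2
  rw [couplingOp, h1, h2]
  rfl

theorem massEquation_iff (hp : p.Admissible) (φo φn φ μ : H1 G) :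
    MassEquation p φo φn φ μ ↔ ∀ v : H1 G,
      3 / (2 * p.δt) * inner ℝ (toL2 (φ - history φo φn)) (toL2 v)
        = -inner ℝ (mobilityOp hp φo φn (grad μ)) (grad v) := by
  refine forall_congr' fun v => ?_
  rw [mobilityOp, inner_mulOp, inner_L2_eq, ← integral_const_mul]
  have e : ∫ x, (3 * toL2 φ x - 4 * toL2 φn x + toL2 φo x) / (2 * p.δt) * toL2 v x ∂G.vol
      = ∫ x, 3 / (2 * p.δt) * (toL2 (φ - history φo φn) x * toL2 v x) ∂G.vol := by
    refine integral_congr_ae ?_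
    filter_upwards [coeFn_history φo φn, Lp.coeFn_sub (toL2 φ) (toL2 (history φo φn))]
      with x h1 h2
    have h3 : toL2 (φ - history φo φn) x = toL2 φ x - (4 * toL2 φn x - toL2 φo x) / 3 := by
      rw [← h1]; exact h2
    rw [h3]
    have := hp.δt_pos.ne'
    field_simp
    ring
  rw [e]

theorem isReducedStep_iff (hp : p.Admissible) (φo φn : H1 G) (Uo Un : L2 G) (φ μ : H1 G) :
    IsReducedStep p φo φn Uo Un φ μ ↔ (schemeData hp φo φn).IsSolution
      (rhsFunctional hp φo φn Uo Un) (φ - history φo φn) μ := by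
  set N := history φo φn with hN
  set K := couplingOp hp φo φn with hK
  have hg : ∀ w : H1 G, ∫ x, (p.H (extrap φo φn x) * ((4 * Un x - Uo x) / 3)
        - 1 / 2 * p.H (extrap φo φn x) ^ 2 * ((4 * toL2 φn x - toL2 φo x) / 3)) * toL2 w x ∂G.vol
      = inner ℝ (K (auxHistory Uo Un)) (toL2 w) - 1 / 2 * inner ℝ (K (toL2 N)) (K (toL2 w)) := by
    intro w
    have e : K (auxHistory Uo Un) - (1 / 2 : ℝ) • K (K (toL2 N)) =ᵐ[G.vol] fun x =>
        p.H (extrap φo φn x) * ((4 * Un x - Uo x) / 3)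
        - 1 / 2 * p.H (extrap φo φn x) ^ 2 * ((4 * toL2 φn x - toL2 φo x) / 3) := by
      filter_upwards [Lp.coeFn_sub (K (auxHistory Uo Un)) ((1 / 2 : ℝ) • K (K (toL2 N))),
        Lp.coeFn_smul (1 / 2 : ℝ) (K (K (toL2 N))),
        coeFn_mulOp (measurable_H_extrap hp φo φn) (fun _ => Params.abs_H_le hp _)
          (K (toL2 N)),
        coeFn_mulOp (measurable_H_extrap hp φo φn) (fun _ => Params.abs_H_le hp _) (toL2 N),
        coeFn_mulOp (measurable_H_extrap hp φo φn) (fun _ => Params.abs_H_le hp _)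
          (auxHistory Uo Un), coeFn_auxHistory Uo Un, coeFn_history φo φn]
        with x h1 h2 h3 h4 h5 h6 h7
      have h3' : K (K (toL2 N)) x = p.H (extrap φo φn x) • K (toL2 N) x := h3
      have h4' : K (toL2 N) x = p.H (extrap φo φn x) • toL2 N x := h4
      have h5' : K (auxHistory Uo Un) x = p.H (extrap φo φn x) • auxHistory Uo Un x := h5
      rw [h1, Pi.sub_apply, h2, Pi.smul_apply, h3', h4', h5', h6, hN, h7]
      simp only [smul_eq_mul]
      ring
    have e2 : inner ℝ (K (K (toL2 N))) (toL2 w) = inner ℝ (K (toL2 N)) (K (toL2 w)) :=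
      mulOp_symm _ _ _ _
    rw [← e2, ← real_inner_smul_left, ← inner_sub_left, inner_L2_eq]
    refine integral_congr_ae ?_
    filter_upwards [e] with x hx
    rw [hx]
  have hpot : ∀ w : H1 G, (∫ x, toL2 μ x * toL2 w x ∂G.vol
      = formP p φo φn φ w
        + ∫ x, (p.H (extrap φo φn x) * ((4 * Un x - Uo x) / 3)
            - 1 / 2 * p.H (extrap φo φn x) ^ 2 * ((4 * toL2 φn x - toL2 φo x) / 3)) * toL2 w x ∂G.vol)
      ↔ inner ℝ (toL2 μ) (toL2 w) = (schemeData hp φo φn).form (φ - N) w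
        - rhsFunctional hp φo φn Uo Un w := by
    intro w
    rw [hg, ← inner_L2_eq, formP_eq hp, rhsFunctional_apply]
    have e : (schemeData hp φo φn).form (φ - N) w = (schemeData hp φo φn).form φ w
        - (p.ε ^ 2 * inner ℝ (grad N) (grad w) + 1 / 2 * inner ℝ (K (toL2 N)) (K (toL2 w))) := by
      have f : ∀ a : H1 G, (schemeData hp φo φn).form a w = p.ε ^ 2 * inner ℝ (grad a) (grad w)
        + 1 / 2 * inner ℝ (K (toL2 a)) (K (toL2 w)) := fun a => rfl
      have e1 : inner ℝ (grad (φ - N)) (grad w)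
          = inner ℝ (grad φ) (grad w) - inner ℝ (grad N) (grad w) := inner_sub_left _ _ _
      have e2 : inner ℝ (K (toL2 (φ - N))) (K (toL2 w))
          = inner ℝ (K (toL2 φ)) (K (toL2 w)) - inner ℝ (K (toL2 N)) (K (toL2 w)) := by
        rw [← inner_sub_left, ← map_sub]; rfl
      rw [f, f, e1, e2]
      ring
    rw [e]
    refine Eq.congr_right ?_
    ring
  exact ⟨fun h => ⟨(massEquation_iff hp φo φn φ μ).1 h.mass, fun w => (hpot w).1 (h.potential w)⟩,
    fun h => ⟨(massEquation_iff hp φo φn φ μ).2 h.mass, fun w => (hpot w).2 (h.potential w)⟩⟩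

/-- The auxiliary equation determines `Uⁿ⁺¹`, and eliminating it gives the reduced scheme. -/
theorem isBDF2Step_iff (hp : p.Admissible) (φo φn : H1 G) (Uo Un : L2 G) (φ μ : H1 G) (U : L2 G) :
    IsBDF2Step p φo φn Uo Un φ μ U ↔ (schemeData hp φo φn).IsSolution
      (rhsFunctional hp φo φn Uo Un) (φ - history φo φn) μ ∧
      U = auxHistory Uo Un
        + (1 / 2 : ℝ) • couplingOp hp φo φn (toL2 (φ - history φo φn)) := by
  set N := history φo φn with hN
  set K := couplingOp hp φo φn with hK
  have haux : (∀ᵐ x ∂G.vol, 2 * (3 * U x - 4 * Un x + Uo x)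
      = p.H (extrap φo φn x) * (3 * toL2 φ x - 4 * toL2 φn x + toL2 φo x)) ↔
      U = auxHistory Uo Un + (1 / 2 : ℝ) • K (toL2 (φ - N)) := by
    rw [Lp.ext_iff]
    have e : ∀ᵐ x ∂G.vol, (auxHistory Uo Un + (1 / 2 : ℝ) • K (toL2 (φ - N)) : L2 G) x
        = (4 * Un x - Uo x) / 3 + 1 / 2 * (p.H (extrap φo φn x)
          * (toL2 φ x - (4 * toL2 φn x - toL2 φo x) / 3)) := by
      filter_upwards [Lp.coeFn_add (auxHistory Uo Un) ((1 / 2 : ℝ) • K (toL2 (φ - N))),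
        Lp.coeFn_smul (1 / 2 : ℝ) (K (toL2 (φ - N))),
        coeFn_mulOp (measurable_H_extrap hp φo φn) (fun _ => Params.abs_H_le hp _)
          (toL2 (φ - N)), coeFn_auxHistory Uo Un, coeFn_history φo φn,
        Lp.coeFn_sub (toL2 φ) (toL2 N)] with x h1 h2 h3 h4 h5 h6
      have h3' : K (toL2 (φ - N)) x = p.H (extrap φo φn x) • toL2 (φ - N) x := h3
      have h6' : toL2 (φ - N) x = toL2 φ x - toL2 N x := h6
      rw [h1, Pi.add_apply, h2, Pi.smul_apply, h3', h4, h6', hN, h5]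
      rfl
    constructor
    · intro h
      filter_upwards [h, e] with x h1 h2
      rw [h2]
      linear_combination (1 / 6 : ℝ) * h1
    · intro h
      filter_upwards [h, e] with x h1 h2
      rw [h1, h2]
      ring
  have hpot : U = auxHistory Uo Un + (1 / 2 : ℝ) • K (toL2 (φ - N)) → ∀ w : H1 G,
      ((∫ x, toL2 μ x * toL2 w x ∂G.vol
        = p.ε ^ 2 * ∫ x, inner ℝ (grad φ x) (grad w x) ∂G.vol
          + ∫ x, U x * p.H (extrap φo φn x) * toL2 w x ∂G.vol)
      ↔ inner ℝ (toL2 μ) (toL2 w) = (schemeData hp φo φn).form (φ - N) w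
        - rhsFunctional hp φo φn Uo Un w) := by
    intro hU w
    have e1 : ∫ x, U x * p.H (extrap φo φn x) * toL2 w x ∂G.vol = inner ℝ (K U) (toL2 w) := by
      rw [hK, couplingOp, inner_mulOp]
      refine integral_congr_ae (Filter.Eventually.of_forall fun x => ?_)
      simp
      ring
    have e2 : inner ℝ (K (K (toL2 (φ - N)))) (toL2 w)
        = inner ℝ (K (toL2 (φ - N))) (K (toL2 w)) := mulOp_symm _ _ _ _
    have e3 : inner ℝ (grad (φ - N)) (grad w)
        = inner ℝ (grad φ) (grad w) - inner ℝ (grad N) (grad w) := inner_sub_left _ _ _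
    have e4 : (schemeData hp φo φn).form (φ - N) w = p.ε ^ 2 * inner ℝ (grad (φ - N)) (grad w)
        + 1 / 2 * inner ℝ (K (toL2 (φ - N))) (K (toL2 w)) := rfl
    rw [e1, ← L2.inner_def, ← inner_L2_eq, hU, map_add, map_smul, inner_add_left,
      real_inner_smul_left, e2, e4, e3, rhsFunctional_apply]
    refine Eq.congr_right ?_
    ring
  constructor
  · intro h
    have hU := haux.1 h.auxiliary
    exact ⟨⟨(massEquation_iff hp φo φn φ μ).1 h.mass, fun w => (hpot hU w).1 (h.potential w)⟩, hU⟩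
  · rintro ⟨h, hU⟩
    exact ⟨(massEquation_iff hp φo φn φ μ).2 h.mass, fun w => (hpot hU w).2 (h.potential w),
      haux.2 hU⟩

theorem isInvQuasiLaplace_iff (hp : p.Admissible) (φo φn : H1 G) (u v : MeanZero G) :
    IsInvQuasiLaplace p φo φn u v ↔ v = (schemeData hp φo φn).invLaplace u := by
  have e : IsInvQuasiLaplace p φo φn u v ↔ ∀ w : H1 G,
      -inner ℝ (mobilityOp hp φo φn (grad v.1)) (grad w) = inner ℝ (toL2 u.1) (toL2 w) := by
    refine forall_congr' fun w => ?_
    rw [mobilityOp, inner_mulOp, inner_L2_eq]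
  rw [e]
  constructor
  · exact fun h => (schemeData hp φo φn).invLaplace_unique fun w => h w
  · rintro rfl
    exact (schemeData hp φo φn).invLaplace_spec u

theorem isSchemeOperator_operator (hp : p.Admissible) (φo φn : H1 G) :
    IsSchemeOperator p φo φn (schemeData hp φo φn).operator := by
  intro ψ v hv χ
  rw [isInvQuasiLaplace_iff hp] at hv
  subst hv
  rw [formP_eq hp, ← inner_L2_eq]
  exact (schemeData hp φo φn).operator_apply ψ χ

theorem dissipation_eq (hp : p.Admissible) (φo φn μ : H1 G) :
    dissipation p φo φn μ = inner ℝ (mobilityOp hp φo φn (grad μ)) (grad μ) := by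
  rw [dissipation, mobilityOp, inner_mulOp]
  refine integral_congr_ae (Filter.Eventually.of_forall fun x => ?_)
  simp only
  rw [norm_smul, mul_pow, Real.norm_eq_abs, sq_abs,
    Real.sq_sqrt (Params.mobility_pos hp _).le, real_inner_self_eq_norm_sq]

/-- Discrete energy law: test the mass equation with `μ` and the potential equation with
`φ - history`, and use the telescoping inequality for `∇φ` and for `U`. -/
theorem energy_law (hp : p.Admissible) {φo φn : H1 G} {Uo Un : L2 G} {φ μ : H1 G} {U : L2 G}
    (h : IsBDF2Step p φo φn Uo Un φ μ U) :
    (1 / p.δt) * (energy p φn φ Un U - energy p φo φn Uo Un) ≤ -dissipation p φo φn μ := by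
  obtain ⟨hsol, hU⟩ := (isBDF2Step_iff hp φo φn Uo Un φ μ U).1 h
  set N := history φo φn with hN
  set K := couplingOp hp φo φn with hK
  have hmass : 3 / (2 * p.δt) * inner ℝ (toL2 (φ - N)) (toL2 μ)
      = -inner ℝ (mobilityOp hp φo φn (grad μ)) (grad μ) := hsol.mass μ
  have hpot : inner ℝ (toL2 μ) (toL2 (φ - N))
      = p.ε ^ 2 * inner ℝ (grad (φ - N)) (grad (φ - N))
        + 1 / 2 * inner ℝ (K (toL2 (φ - N))) (K (toL2 (φ - N)))
        - (-(p.ε ^ 2 * inner ℝ (grad N) (grad (φ - N)))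
          - inner ℝ (K (auxHistory Uo Un)) (toL2 (φ - N))) := hsol.potential (φ - N)
  have hKs : inner ℝ (K (auxHistory Uo Un)) (toL2 (φ - N))
      = inner ℝ (auxHistory Uo Un) (K (toL2 (φ - N))) := mulOp_symm _ _ _ _
  have hg : (3 : ℝ) • grad (φ - N) = (3 : ℝ) • grad φ - (4 : ℝ) • grad φn + grad φo := by
    have : grad (φ - N) = grad φ - (1 / 3 : ℝ) • ((4 : ℝ) • grad φn - grad φo) := rfl
    rw [this]
    module
  have hg' : grad φ = grad (φ - N) + grad N := by
    have : grad (φ - N) = grad φ - grad N := rfl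
    rw [this, sub_add_cancel]
  have hKU : K (toL2 (φ - N)) = (2 / 3 : ℝ) • ((3 : ℝ) • U - (4 : ℝ) • Un + Uo) := by
    rw [hU, auxHistory]
    module
  have hU' : U = auxHistory Uo Un + (1 / 2 : ℝ) • K (toL2 (φ - N)) := hU
  -- the chemical potential paired with the increment splits into a gradient and a `U` part
  have hsplit : 3 * inner ℝ (toL2 μ) (toL2 (φ - N))
      = p.ε ^ 2 * inner ℝ (grad φ) ((3 : ℝ) • grad φ - (4 : ℝ) • grad φn + grad φo)
        + 2 * inner ℝ U ((3 : ℝ) • U - (4 : ℝ) • Un + Uo) := by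
    have e1 : inner ℝ (grad φ) ((3 : ℝ) • grad φ - (4 : ℝ) • grad φn + grad φo)
        = 3 * (inner ℝ (grad (φ - N)) (grad (φ - N)) + inner ℝ (grad N) (grad (φ - N))) := by
      rw [← hg, real_inner_smul_right, ← inner_add_left, ← hg']
    have e2 : inner ℝ U (K (toL2 (φ - N)))
        = 2 / 3 * inner ℝ U ((3 : ℝ) • U - (4 : ℝ) • Un + Uo) := by
      rw [hKU, real_inner_smul_right]
    have e3 : inner ℝ U (K (toL2 (φ - N))) = inner ℝ (auxHistory Uo Un) (K (toL2 (φ - N)))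
        + 1 / 2 * inner ℝ (K (toL2 (φ - N))) (K (toL2 (φ - N))) := by
      conv_lhs => rw [hU']
      rw [inner_add_left, real_inner_smul_left]
    rw [hpot, hKs, e1]
    linear_combination 3 * e2 - 3 * e3
  have t1 := bdf2_inner_ge (grad φ) (grad φn) (grad φo)
  have t2 := bdf2_inner_ge U Un Uo
  have hδ := hp.δt_pos
  rw [dissipation_eq hp, ← hmass, real_inner_comm]
  have e : 3 / (2 * p.δt) * inner ℝ (toL2 μ) (toL2 (φ - N))
      = 1 / p.δt * (3 * inner ℝ (toL2 μ) (toL2 (φ - N)) / 2) := by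
    field_simp
  rw [e, hsplit]
  refine mul_le_mul_of_nonneg_left ?_ (by positivity)
  unfold energy
  nlinarith [mul_le_mul_of_nonneg_left t1 (sq_nonneg p.ε)]

theorem existsUnique_isReducedStep (hp : p.Admissible) (φo φn : H1 G) (Uo Un : L2 G) :
    ∃! s : H1 G × H1 G, IsReducedStep p φo φn Uo Un s.1 s.2 := by
  obtain ⟨ψ, μ, h⟩ := (schemeData hp φo φn).exists_solution (rhsFunctional hp φo φn Uo Un)
  rw [← add_sub_cancel_right ψ (history φo φn)] at h
  refine ⟨(ψ + history φo φn, μ), (isReducedStep_iff hp φo φn Uo Un _ _).2 h, ?_⟩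
  rintro ⟨φ', μ'⟩ h'
  obtain ⟨e1, e2⟩ := ((isReducedStep_iff hp φo φn Uo Un _ _).1 h').unique h
  exact Prod.ext (sub_left_injective e1) e2

theorem existsUnique_isBDF2Step (hp : p.Admissible) (φo φn : H1 G) (Uo Un : L2 G) :
    ∃! s : H1 G × H1 G × L2 G, IsBDF2Step p φo φn Uo Un s.1 s.2.1 s.2.2 := by
  obtain ⟨ψ, μ, h⟩ := (schemeData hp φo φn).exists_solution (rhsFunctional hp φo φn Uo Un)
  rw [← add_sub_cancel_right ψ (history φo φn)] at h
  refine ⟨(ψ + history φo φn, μ, auxHistory Uo Un + (1 / 2 : ℝ) •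
    couplingOp hp φo φn (toL2 (ψ + history φo φn - history φo φn))),
    (isBDF2Step_iff hp φo φn Uo Un _ _ _).2 ⟨h, rfl⟩, ?_⟩
  rintro ⟨φ', μ', U'⟩ h'
  obtain ⟨h1, h2⟩ := (isBDF2Step_iff hp φo φn Uo Un φ' μ' U').1 h'
  obtain ⟨e1, e2⟩ := h1.unique h
  rw [e1] at h2
  exact Prod.ext (sub_left_injective e1) (Prod.ext e2 h2)

/-- The scheme is equivalent to the linear equation for `φ - history` on the mean-zero subspace. -/
theorem exists_isBDF2Step_iff (hp : p.Admissible) (φo φn : H1 G) (Uo Un : L2 G) (φ : H1 G) :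
    (∃ (μ : H1 G) (U : L2 G), IsBDF2Step p φo φn Uo Un φ μ U) ↔
      ∃ ψ : (schemeData hp φo φn).V, (ψ : H1 G) = φ - history φo φn ∧
        ∀ χ : (schemeData hp φo φn).V, (schemeData hp φo φn).operator ψ χ
          = rhsFunctional hp φo φn Uo Un χ := by
  constructor
  · rintro ⟨μ, U, h⟩
    have h1 := ((isBDF2Step_iff hp φo φn Uo Un φ μ U).1 h).1
    exact ⟨⟨φ - history φo φn, h1.mem_V⟩, rfl, fun χ =>
      VariationalData.IsSolution.operator_eq (ψ := ⟨φ - history φo φn, h1.mem_V⟩) h1 χ⟩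
  · rintro ⟨ψ, hψ, h⟩
    obtain ⟨μ, hμ⟩ := VariationalData.exists_isSolution h
    rw [hψ] at hμ
    exact ⟨μ, _, (isBDF2Step_iff hp φo φn Uo Un φ μ _).2 ⟨hμ, rfl⟩⟩

theorem existsUnique_isInvQuasiLaplace (hp : p.Admissible) (φo φn : H1 G) (ψ : MeanZero G) :
    ∃! v : MeanZero G, IsInvQuasiLaplace p φo φn ψ v :=
  ⟨(schemeData hp φo φn).invLaplace ψ, (isInvQuasiLaplace_iff hp φo φn _ _).2 rfl,
    fun _ hv => (isInvQuasiLaplace_iff hp φo φn _ _).1 hv⟩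

theorem exists_le_operator (hp : p.Admissible) (φo φn : H1 G) :
    ∃ C : ℝ, 0 < C ∧ ∀ ψ : (schemeData hp φo φn).V,
      C * ‖ψ‖ ^ 2 ≤ (schemeData hp φo φn).operator ψ ψ := by
  obtain ⟨C, hC, h⟩ := (schemeData hp φo φn).isCoercive_operator
  exact ⟨C, hC, fun ψ => by rw [sq, ← mul_assoc]; exact h ψ⟩

theorem dissipation_nonneg (φo φn μ : H1 G) : 0 ≤ dissipation p φo φn μ :=
  integral_nonneg fun _ => sq_nonneg _

end Scheme

end CahnHilliard

theorem theorem3p3 (d : ℕ) (hd : 1 ≤ d) (G : Setting d) (p : Params) (hp : p.Admissible)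
    (φo φn : H1 G) (Uo Un : L2 G) :
    -- unique solvability of the scheme, and of its reduced form
    (∃! s : H1 G × H1 G × L2 G, IsBDF2Step p φo φn Uo Un s.1 s.2.1 s.2.2) ∧
    (∃! s : H1 G × H1 G, IsReducedStep p φo φn Uo Un s.1 s.2) ∧
    -- the linear operator of the scheme is well defined, symmetric and positive definite
    (∀ ψ : MeanZero G, ∃! v : MeanZero G, IsInvQuasiLaplace p φo φn ψ v) ∧
    (∃ A : MeanZero G →L[ℝ] (MeanZero G →L[ℝ] ℝ),
      IsSchemeOperator p φo φn A ∧
      (∀ φ : H1 G, (∃ (μ : H1 G) (U : L2 G), IsBDF2Step p φo φn Uo Un φ μ U) ↔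
        ∃ ψ : MeanZero G, (ψ : H1 G) = φ - history φo φn ∧
          ∀ χ : MeanZero G, A ψ χ = schemeRhs p φo φn Uo Un χ) ∧
      (∀ ψ χ : MeanZero G, A ψ χ = A χ ψ) ∧
      (∀ ψ : MeanZero G, ψ ≠ 0 → 0 < A ψ ψ) ∧
      (∃ C : ℝ, 0 < C ∧ ∀ ψ : MeanZero G, C * ‖ψ‖ ^ 2 ≤ A ψ ψ)) ∧
    -- the discrete energy dissipation law
    (∀ (φ μ : H1 G) (U : L2 G), IsBDF2Step p φo φn Uo Un φ μ U →
      (1 / p.δt) * (energy p φn φ Un U - energy p φo φn Uo Un) ≤ -dissipation p φo φn μ ∧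
      -dissipation p φo φn μ ≤ 0) := by
  obtain ⟨C, hC, hA⟩ := exists_le_operator hp φo φn
  refine ⟨existsUnique_isBDF2Step hp φo φn Uo Un, existsUnique_isReducedStep hp φo φn Uo Un,
    existsUnique_isInvQuasiLaplace hp φo φn,
    ⟨(schemeData hp φo φn).operator, isSchemeOperator_operator hp φo φn, fun φ => ?_,
      (schemeData hp φo φn).operator_symm, fun ψ hψ => ?_, C, hC, hA⟩,
    fun φ μ U h => ⟨energy_law hp h, neg_nonpos.2 (dissipation_nonneg φo φn μ)⟩⟩
  · simp_rw [schemeRhs_eq hp]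
    exact exists_isBDF2Step_iff hp φo φn Uo Un φ
  · have : 0 < ‖ψ‖ := norm_pos_iff.2 hψ
    exact lt_of_lt_of_le (by positivity) (hA ψ)
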